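/- All operads are symmetric operads of complex vector spaces. For a finite-dimensional $\mathbb S_2$-module $E$ and an $\mathbb S_3$-submodule $R\subset\mathcal F(E)(3)$ of the free operad $\mathcal F(E)$ on $E$ placed in arity $2$, let $\mathcal P(E,R)=\mathcal F(E)/(R)$ be the corresponding binary quadratic operad. Its Koszul dual is $\mathcal P(E,R)^!=\mathcal P(E^\vee,R^\perp)$, where $E^\vee=E^*\otimes\mathrm{sgn}_2$ and $R^\perp\subset\mathcal F(E^\vee)(3)$ is the orthogonal complement of $R$ for the sign-invariant pairing of $\mathcal F(E^\vee)(3)$ with $\mathcal F(E)(3)$ (the three copies of $E\otimes E$ in $\mathcal F(E)(3)$, given by the operations $e(f(x_1,x_2),x_3)$, $e(f(x_2,x_3),x_1)$, $e(f(x_3,x_1),x_2)$, are paired componentwise with the corresponding copies of $E^\vee\otimes E^\vee$). Let $\mathrm{Lie}$ be the operad of Lie algebras, $\mathrm{As}\text{-}\mathrm{Com}$ the operad of commutative associative algebras, and $\mathrm{MP}$ the operad of mixed-Poisson algebras: it is generated by an anticommutative operation $\mu=\{x_1,x_2\}$ and a commutative operation $\nu=x_1\cdot x_2$, subject to the Jacobi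 identity for $\{\cdot,\cdot\}$, the associativity of $\cdot$, and the identities $\{x\cdot y,z\}=0$ and $\{x,y\}\cdot z=0$. **Theorem.** There is an isomorphism of operads $$\mathrm{MP}^!\;\cong\;\mathrm{Lie}\ast \mathrm{As}\text{-}\mathrm{Com},$$ where $\ast$ is the free product (coproduct) of operads. Moreover, if $(\mu^\vee,\nu^\vee)$ is the basis dual to $(\mu,\nu)$, then in $\mathrm{MP}^!$ the generator $\mu^\vee$ is commutative, $\nu^\vee$ is anticommutative, and the space of quadratic relations $R^\perp$ is spanned by the associativity relations of $\mu^\vee$ and the Jacobi relation of $\nu^\vee$; in particular there are no relations mixing the two operations. -/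

import Mathlib

open scoped TensorProduct

universe u v w

/-! ## Symmetric operads

Symmetric operads in the category of `K`-modules, in coordinate-free form: the components are
indexed by finite sets of inputs (`P(n)` is `obj (Fin n)`, with `Perm (Fin n)` acting by `map`),
and the composition `comp p q` plugs the output of `q i` into the input `i` of `p`. -/

/-- A symmetric operad in `K`-modules, presented on the groupoid of finite sets and bijections. -/
structure SymmOperad (K : Type u) [Field K] where
  /-- the module of operations with set of inputs `I` -/
  obj : (I : Type) → [Finite I] → Type v
  [grp : ∀ (I : Type) [Finite I], AddCommGroup (obj I)]
  [mod : ∀ (I : Type) [Finite I], Module K (obj I)]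
  /-- relabelling of the inputs -/
  map : ∀ {I J : Type} [Finite I] [Finite J], (I ≃ J) → (obj I →ₗ[K] obj J)
  /-- the identity operation -/
  unit : obj (Fin 1)
  /-- the operadic composition -/
  comp : ∀ {I : Type} {J : I → Type} [Finite I] [∀ i, Finite (J i)],
    obj I →ₗ[K] MultilinearMap K (fun i => obj (J i)) (obj (Σ i, J i))
  map_refl : ∀ {I : Type} [Finite I] (x : obj I), map (Equiv.refl I) x = x
  map_trans : ∀ {I J L : Type} [Finite I] [Finite J] [Finite L] (e : I ≃ J) (f : J ≃ L)
    (x : obj I), map (e.trans f) x = map f (map e x)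
  unit_comp : ∀ {J : Fin 1 → Type} [∀ i, Finite (J i)] (q : ∀ i, obj (J i)),
    map (Equiv.uniqueSigma J) (comp unit q) = q default
  comp_unit : ∀ {I : Type} [Finite I] (p : obj I),
    map (Equiv.sigmaUnique I (fun _ => Fin 1)) (comp p (fun _ => unit)) = p
  comp_assoc : ∀ {I : Type} {J : I → Type} {L : ∀ i, J i → Type} [Finite I]
    [∀ i, Finite (J i)] [∀ i j, Finite (L i j)]
    (p : obj I) (q : ∀ i, obj (J i)) (r : ∀ i j, obj (L i j)),
    map (Equiv.sigmaAssoc L) (comp (comp p q) (fun x : (Σ i, J i) => r x.1 x.2)) =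
      comp p (fun i => comp (q i) (r i))
  map_comp : ∀ {I I' : Type} {J : I' → Type} [Finite I] [Finite I'] [∀ i, Finite (J i)]
    (e : I ≃ I') (p : obj I) (q : ∀ i, obj (J i)),
    comp (map e p) q = map (Equiv.sigmaCongrLeft e) (comp p (fun i => q (e i)))
  comp_map : ∀ {I : Type} {J J' : I → Type} [Finite I] [∀ i, Finite (J i)]
    [∀ i, Finite (J' i)] (f : ∀ i, J i ≃ J' i) (p : obj I) (q : ∀ i, obj (J i)),
    comp p (fun i => map (f i) (q i)) = map (Equiv.sigmaCongrRight f) (comp p q)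

namespace SymmOperad

attribute [instance] SymmOperad.grp SymmOperad.mod

variable {K : Type u} [Field K]

/-- An isomorphism of symmetric operads. -/
structure Iso (P : SymmOperad.{u, v} K) (Q : SymmOperad.{u, w} K) where
  toEquiv : ∀ (I : Type) [Finite I], P.obj I ≃ₗ[K] Q.obj I
  map' : ∀ {I J : Type} [Finite I] [Finite J] (e : I ≃ J) (x : P.obj I),
    toEquiv J (P.map e x) = Q.map e (toEquiv I x)
  unit' : toEquiv (Fin 1) P.unit = Q.unit
  comp' : ∀ {I : Type} {J : I → Type} [Finite I] [∀ i, Finite (J i)]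
    (p : P.obj I) (q : ∀ i, P.obj (J i)),
    toEquiv (Σ i, J i) (P.comp p q) = Q.comp (toEquiv I p) (fun i => toEquiv (J i) (q i))

/-! ### Compositions of two binary operations -/

/-- The sets of inputs of the two operations plugged into `x` in `x(y(-, -), -)`. -/
abbrev nestInputs (i : Fin 2) : Type := Fin (![2, 1] i)

/-- The operations plugged into `x` in `x(y(-, -), -)`: the operation `y` and the identity. -/
def nestArgs (P : SymmOperad.{u, v} K) (y : P.obj (Fin 2)) : ∀ i : Fin 2, P.obj (nestInputs i)
  | 0 => y
  | 1 => P.unit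

/-- The labelling of the three inputs of `x(y(-, -), -)`, in their order from left to right, by
`s`, `s + 1`, `s + 2` (modulo three). -/
def nestLabel (s : Fin 3) : (Σ i, nestInputs i) ≃ Fin 3 :=
  (finSigmaFinEquiv.trans (finCongr (by simp))).trans (Equiv.addRight s)

theorem nestArgs_eq_update (P : SymmOperad.{u, v} K) (y : P.obj (Fin 2)) :
    P.nestArgs y = Function.update (P.nestArgs 0) 0 y := by
  funext i
  fin_cases i
  · exact (Function.update_self (0 : Fin 2) y (P.nestArgs 0)).symm
  · exact (Function.update_of_ne (by decide : (1 : Fin 2) ≠ 0) y (P.nestArgs 0)).symm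

/-- The operation `x(y(x_s, x_{s+1}), x_{s+2})` (indices modulo three), bilinear in the binary
operations `x` and `y`. -/
def nest (P : SymmOperad.{u, v} K) (s : Fin 3) :
    P.obj (Fin 2) →ₗ[K] P.obj (Fin 2) →ₗ[K] P.obj (Fin 3) :=
  LinearMap.mk₂ K (fun x y => P.map (nestLabel s) (P.comp x (P.nestArgs y)))
    (fun x x' y => by rw [map_add, add_apply, map_add])
    (fun c x y => by rw [map_smul, smul_apply, map_smul])
    (fun x y y' => by
      rw [nestArgs_eq_update, nestArgs_eq_update P y, nestArgs_eq_update P y', ← map_add]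
      exact congrArg _ (MultilinearMap.map_update_add _ _ _ _ _))
    (fun c x y => by
      rw [nestArgs_eq_update, nestArgs_eq_update P y, ← map_smul]
      exact congrArg _ (MultilinearMap.map_update_smul _ _ _ _ _))

/-! ### Operadic ideals and quotients -/

/-- A (two-sided, symmetric) operadic ideal. -/
structure OpIdeal (P : SymmOperad.{u, v} K) where
  sub : ∀ (I : Type) [Finite I], Submodule K (P.obj I)
  map_mem : ∀ {I J : Type} [Finite I] [Finite J] (e : I ≃ J) (x : P.obj I),
    x ∈ sub I → P.map e x ∈ sub J
  comp_mem_left : ∀ {I : Type} {J : I → Type} [Finite I] [∀ i, Finite (J i)]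
    (p : P.obj I) (q : ∀ i, P.obj (J i)), p ∈ sub I → P.comp p q ∈ sub (Σ i, J i)
  comp_mem_right : ∀ {I : Type} {J : I → Type} [Finite I] [∀ i, Finite (J i)]
    (p : P.obj I) (q : ∀ i, P.obj (J i)) (i : I), q i ∈ sub (J i) →
    P.comp p q ∈ sub (Σ i, J i)

/-- The ideal generated by a family of sets of operations: the smallest ideal containing it. -/
def idealSpan (P : SymmOperad.{u, v} K) (S : ∀ (I : Type) [Finite I], Set (P.obj I)) :
    OpIdeal P where
  sub I _ := sInf {N | ∃ T : OpIdeal P, (∀ (J : Type) [Finite J], S J ⊆ T.sub J) ∧ N = T.sub I}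
  map_mem e x hx := by
    simp only [Submodule.mem_sInf, Set.mem_ofPred_eq, forall_exists_index, and_imp] at hx ⊢
    rintro _ T hT rfl
    exact T.map_mem e x (hx _ T hT rfl)
  comp_mem_left p q hp := by
    simp only [Submodule.mem_sInf, Set.mem_ofPred_eq, forall_exists_index, and_imp] at hp ⊢
    rintro _ T hT rfl
    exact T.comp_mem_left p q (hp _ T hT rfl)
  comp_mem_right p q i hq := by
    simp only [Submodule.mem_sInf, Set.mem_ofPred_eq, forall_exists_index, and_imp] at hq ⊢
    rintro _ T hT rfl
    exact T.comp_mem_right p q i (hq _ T hT rfl)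

theorem subset_idealSpan (P : SymmOperad.{u, v} K)
    (S : ∀ (I : Type) [Finite I], Set (P.obj I)) (I : Type) [Finite I] {x : P.obj I}
    (hx : x ∈ S I) : x ∈ (P.idealSpan S).sub I := by
  simp only [idealSpan, Submodule.mem_sInf, Set.mem_ofPred_eq, forall_exists_index, and_imp]
  rintro _ T hT rfl
  exact hT I hx

theorem OpIdeal.comp_sub_mem {P : SymmOperad.{u, v} K} (T : OpIdeal P) {I : Type}
    {J : I → Type} [Finite I] [∀ i, Finite (J i)] (p p' : P.obj I) (q q' : ∀ i, P.obj (J i))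
    (hp : p - p' ∈ T.sub I) (hq : ∀ i, q i - q' i ∈ T.sub (J i)) :
    P.comp p q - P.comp p' q' ∈ T.sub (Σ i, J i) := by
  classical
  have := Fintype.ofFinite I
  have key : ∀ s : Finset I, P.comp p' (s.piecewise q q') - P.comp p' q' ∈ T.sub (Σ i, J i) := by
    intro s
    induction s using Finset.induction_on with
    | empty => simp
    | insert a s ha ih =>
      rw [Finset.piecewise_insert]
      have h1 : P.comp p' (Function.update (s.piecewise q q') a (q a)) -
          P.comp p' (s.piecewise q q') ∈ T.sub (Σ i, J i) := by
        have h2 : P.comp p' (s.piecewise q q') =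
            P.comp p' (Function.update (s.piecewise q q') a (q' a)) := by
          congr 1
          rw [eq_comm, Function.update_eq_self_iff, Finset.piecewise_eq_of_notMem _ _ _ ha]
        rw [h2, ← MultilinearMap.map_update_sub]
        exact T.comp_mem_right _ _ a (by simpa using hq a)
      have := Submodule.add_mem _ h1 ih
      simpa using this
  have h1 := key Finset.univ
  rw [Finset.piecewise_univ] at h1
  have h2 := T.comp_mem_left (p - p') q hp
  rw [map_sub, sub_apply] at h2
  have := Submodule.add_mem _ h2 h1
  simpa using this

theorem OpIdeal.mk_comp_eq {P : SymmOperad.{u, v} K} (T : OpIdeal P) {I : Type}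
    {J : I → Type} [Finite I] [∀ i, Finite (J i)] (p : P.obj I) (q q' : ∀ i, P.obj (J i))
    (h : ∀ i, (T.sub (J i)).mkQ (q i) = (T.sub (J i)).mkQ (q' i)) :
    (T.sub (Σ i, J i)).mkQ (P.comp p q) = (T.sub (Σ i, J i)).mkQ (P.comp p q') :=
  (Submodule.Quotient.eq _).2 (T.comp_sub_mem p p q q' (by simp)
    fun i => (Submodule.Quotient.eq _).1 (h i))

/-- A representative of a class modulo an ideal. -/
noncomputable def OpIdeal.out {P : SymmOperad.{u, v} K} (T : OpIdeal P) {I : Type} [Finite I]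
    (x : P.obj I ⧸ T.sub I) : P.obj I :=
  Function.surjInv (Submodule.mkQ_surjective (T.sub I)) x

theorem OpIdeal.mk_out {P : SymmOperad.{u, v} K} (T : OpIdeal P) {I : Type} [Finite I]
    (x : P.obj I ⧸ T.sub I) : (T.sub I).mkQ (T.out x) = x :=
  Function.surjInv_eq (Submodule.mkQ_surjective (T.sub I)) x

/-- The composition induced on classes modulo an ideal. -/
noncomputable def OpIdeal.quotComp {P : SymmOperad.{u, v} K} (T : OpIdeal P) {I : Type}
    {J : I → Type} [Finite I] [∀ i, Finite (J i)] :
    (P.obj I ⧸ T.sub I) →ₗ[K]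
      MultilinearMap K (fun i => P.obj (J i) ⧸ T.sub (J i)) (P.obj (Σ i, J i) ⧸ T.sub _) :=
  (T.sub I).liftQ
    { toFun := fun p =>
        { toFun := fun q => (T.sub (Σ i, J i)).mkQ (P.comp p (fun i => T.out (q i)))
          map_update_add' := by
            intro _ m i x y
            have e : ∀ z : P.obj (J i) ⧸ T.sub (J i), ∀ z' : P.obj (J i),
                (T.sub (J i)).mkQ z' = z →
                (T.sub (Σ i, J i)).mkQ
                    (P.comp p (fun j => T.out (Function.update m i z j))) =
                  (T.sub (Σ i, J i)).mkQ
                    (P.comp p (Function.update (fun j => T.out (m j)) i z')) := by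
              intro z z' hz
              refine T.mk_comp_eq p _ _ fun j => ?_
              rw [T.mk_out]
              rcases eq_or_ne j i with rfl | h
              · rw [Function.update_self, Function.update_self, hz]
              · rw [Function.update_of_ne h, Function.update_of_ne h, T.mk_out]
            rw [e (x + y) (T.out x + T.out y) (by rw [map_add, T.mk_out, T.mk_out]),
              e x _ (T.mk_out x), e y _ (T.mk_out y), MultilinearMap.map_update_add, map_add]
          map_update_smul' := by
            intro _ m i c x
            have e : ∀ z : P.obj (J i) ⧸ T.sub (J i), ∀ z' : P.obj (J i),
                (T.sub (J i)).mkQ z' = z →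
                (T.sub (Σ i, J i)).mkQ
                    (P.comp p (fun j => T.out (Function.update m i z j))) =
                  (T.sub (Σ i, J i)).mkQ
                    (P.comp p (Function.update (fun j => T.out (m j)) i z')) := by
              intro z z' hz
              refine T.mk_comp_eq p _ _ fun j => ?_
              rw [T.mk_out]
              rcases eq_or_ne j i with rfl | h
              · rw [Function.update_self, Function.update_self, hz]
              · rw [Function.update_of_ne h, Function.update_of_ne h, T.mk_out]
            rw [e (c • x) (c • T.out x) (by rw [map_smul, T.mk_out]),
              e x _ (T.mk_out x), MultilinearMap.map_update_smul, map_smul] }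
      map_add' := fun p p' => by
        refine MultilinearMap.ext fun q => ?_
        exact (congrArg (T.sub (Σ i, J i)).mkQ (congrArg (fun f => f fun i => T.out (q i))
          (map_add (P.comp (J := J)) p p'))).trans (map_add _ _ _)
      map_smul' := fun c p => by
        refine MultilinearMap.ext fun q => ?_
        exact (congrArg (T.sub (Σ i, J i)).mkQ (congrArg (fun f => f fun i => T.out (q i))
          (map_smul (P.comp (J := J)) c p))).trans (map_smul _ _ _) }
    (fun p hp => by
      rw [LinearMap.mem_ker]
      refine MultilinearMap.ext fun q => ?_
      exact (Submodule.Quotient.mk_eq_zero _).2 (T.comp_mem_left p _ hp))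

theorem OpIdeal.quotComp_mk {P : SymmOperad.{u, v} K} (T : OpIdeal P) {I : Type}
    {J : I → Type} [Finite I] [∀ i, Finite (J i)] (p : P.obj I) (q : ∀ i, P.obj (J i)) :
    T.quotComp ((T.sub I).mkQ p) (fun i => (T.sub (J i)).mkQ (q i)) =
      (T.sub (Σ i, J i)).mkQ (P.comp p q) :=
  T.mk_comp_eq p _ _ fun _ => T.mk_out _

/-- The relabelling induced on classes modulo an ideal. -/
def OpIdeal.quotRelabel {P : SymmOperad.{u, v} K} (T : OpIdeal P) {I J : Type} [Finite I] [Finite J]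
    (e : I ≃ J) : (P.obj I ⧸ T.sub I) →ₗ[K] (P.obj J ⧸ T.sub J) :=
  (T.sub I).mapQ (T.sub J) (P.map e) (fun x hx => T.map_mem e x hx)

theorem OpIdeal.quotRelabel_mk {P : SymmOperad.{u, v} K} (T : OpIdeal P) {I J : Type}
    [Finite I] [Finite J] (e : I ≃ J) (x : P.obj I) :
    T.quotRelabel e ((T.sub I).mkQ x) = (T.sub J).mkQ (P.map e x) := rfl

theorem OpIdeal.exists_rep {P : SymmOperad.{u, v} K} (T : OpIdeal P) {A : Type}
    {J : A → Type} [∀ i, Finite (J i)] (q : ∀ i, P.obj (J i) ⧸ T.sub (J i)) :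
    ∃ q' : ∀ i, P.obj (J i), q = fun i => (T.sub (J i)).mkQ (q' i) :=
  ⟨fun i => T.out (q i), funext fun i => (T.mk_out (q i)).symm⟩

/-- The quotient of an operad by an operadic ideal. -/
noncomputable def quotient (P : SymmOperad.{u, v} K) (T : OpIdeal P) : SymmOperad.{u, v} K where
  obj I _ := P.obj I ⧸ T.sub I
  map e := T.quotRelabel e
  unit := (T.sub (Fin 1)).mkQ P.unit
  comp := T.quotComp
  map_refl x := by
    obtain ⟨x, rfl⟩ := Submodule.mkQ_surjective _ x
    rw [T.quotRelabel_mk, P.map_refl]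
  map_trans e f x := by
    obtain ⟨x, rfl⟩ := Submodule.mkQ_surjective _ x
    rw [T.quotRelabel_mk, T.quotRelabel_mk, T.quotRelabel_mk, P.map_trans]
  unit_comp q := by
    obtain ⟨q, rfl⟩ := T.exists_rep q
    rw [T.quotComp_mk, T.quotRelabel_mk, P.unit_comp]
  comp_unit p := by
    obtain ⟨p, rfl⟩ := Submodule.mkQ_surjective _ p
    rw [T.quotComp_mk p (fun _ => P.unit), T.quotRelabel_mk, P.comp_unit]
  comp_assoc {I J L} _ _ _ p q r := by
    obtain ⟨p, rfl⟩ := Submodule.mkQ_surjective _ p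
    obtain ⟨q, rfl⟩ := T.exists_rep q
    obtain ⟨r', hr⟩ : ∃ r' : ∀ i j, P.obj (L i j), r = fun i j => (T.sub (L i j)).mkQ (r' i j) :=
      ⟨fun i j => T.out (r i j), by simp only [T.mk_out]⟩
    subst hr
    simp only [T.quotComp_mk]
    rw [T.quotRelabel_mk, P.comp_assoc]
  map_comp e p q := by
    obtain ⟨p, rfl⟩ := Submodule.mkQ_surjective _ p
    obtain ⟨q, rfl⟩ := T.exists_rep q
    rw [T.quotRelabel_mk, T.quotComp_mk, T.quotComp_mk p (fun i => q (e i)), T.quotRelabel_mk,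
      P.map_comp]
  comp_map f p q := by
    obtain ⟨p, rfl⟩ := Submodule.mkQ_surjective _ p
    obtain ⟨q, rfl⟩ := T.exists_rep q
    simp only [T.quotRelabel_mk, T.quotComp_mk]
    rw [P.comp_map]

/-- The projection of an operad onto a quotient. -/
def quotientMap (P : SymmOperad.{u, v} K) (T : OpIdeal P) (I : Type) [Finite I] :
    P.obj I →ₗ[K] (P.quotient T).obj I :=
  (T.sub I).mkQ

/-! ### The free operad on a collection of symbols -/

/-- Formal operadic expressions in a collection `G` of symbols (`G I` is the set of symbols with
set of inputs `I`). -/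
inductive Expr (K : Type u) (G : (I : Type) → [Finite I] → Type v) :
    (I : Type) → [Finite I] → Type (max 1 u v)
  | gen {I : Type} [Finite I] (g : G I) : Expr K G I
  | zero {I : Type} [Finite I] : Expr K G I
  | add {I : Type} [Finite I] (x y : Expr K G I) : Expr K G I
  | smul {I : Type} [Finite I] (c : K) (x : Expr K G I) : Expr K G I
  | map {I J : Type} [Finite I] [Finite J] (e : I ≃ J) (x : Expr K G I) : Expr K G J
  | unit : Expr K G (Fin 1)
  | comp {I : Type} {J : I → Type} [Finite I] [∀ i, Finite (J i)] (p : Expr K G I)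
      (q : ∀ i, Expr K G (J i)) : Expr K G (Σ i, J i)

/-- The congruence on formal operadic expressions generated by the axioms of an operad. -/
inductive ExprRel (K : Type u) [Field K] (G : (I : Type) → [Finite I] → Type v) :
    (I : Type) → [Finite I] → Expr K G I → Expr K G I → Prop
  | refl {I : Type} [Finite I] (x : Expr K G I) : ExprRel K G I x x
  | symm {I : Type} [Finite I] {x y : Expr K G I} :
      ExprRel K G I x y → ExprRel K G I y x
  | trans {I : Type} [Finite I] {x y z : Expr K G I} :
      ExprRel K G I x y → ExprRel K G I y z → ExprRel K G I x z
  | add_congr {I : Type} [Finite I] {x x' y y' : Expr K G I} :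
      ExprRel K G I x x' → ExprRel K G I y y' → ExprRel K G I (.add x y) (.add x' y')
  | smul_congr {I : Type} [Finite I] (c : K) {x x' : Expr K G I} :
      ExprRel K G I x x' → ExprRel K G I (.smul c x) (.smul c x')
  | map_congr {I J : Type} [Finite I] [Finite J] (e : I ≃ J) {x x' : Expr K G I} :
      ExprRel K G I x x' → ExprRel K G J (.map e x) (.map e x')
  | comp_congr {I : Type} {J : I → Type} [Finite I] [∀ i, Finite (J i)] {p p' : Expr K G I}
      {q q' : ∀ i, Expr K G (J i)} :
      ExprRel K G I p p' → (∀ i, ExprRel K G (J i) (q i) (q' i)) →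
      ExprRel K G (Σ i, J i) (.comp p q) (.comp p' q')
  | add_assoc {I : Type} [Finite I] (x y z : Expr K G I) :
      ExprRel K G I (.add (.add x y) z) (.add x (.add y z))
  | add_comm {I : Type} [Finite I] (x y : Expr K G I) :
      ExprRel K G I (.add x y) (.add y x)
  | add_zero {I : Type} [Finite I] (x : Expr K G I) : ExprRel K G I (.add x .zero) x
  | add_neg {I : Type} [Finite I] (x : Expr K G I) :
      ExprRel K G I (.add x (.smul (-1) x)) .zero
  | smul_add {I : Type} [Finite I] (c : K) (x y : Expr K G I) :
      ExprRel K G I (.smul c (.add x y)) (.add (.smul c x) (.smul c y))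
  | add_smul {I : Type} [Finite I] (c d : K) (x : Expr K G I) :
      ExprRel K G I (.smul (c + d) x) (.add (.smul c x) (.smul d x))
  | mul_smul {I : Type} [Finite I] (c d : K) (x : Expr K G I) :
      ExprRel K G I (.smul (c * d) x) (.smul c (.smul d x))
  | one_smul {I : Type} [Finite I] (x : Expr K G I) : ExprRel K G I (.smul 1 x) x
  | map_add {I J : Type} [Finite I] [Finite J] (e : I ≃ J) (x y : Expr K G I) :
      ExprRel K G J (.map e (.add x y)) (.add (.map e x) (.map e y))
  | map_smul {I J : Type} [Finite I] [Finite J] (e : I ≃ J) (c : K) (x : Expr K G I) :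
      ExprRel K G J (.map e (.smul c x)) (.smul c (.map e x))
  | comp_add_left {I : Type} {J : I → Type} [Finite I] [∀ i, Finite (J i)]
      (p p' : Expr K G I) (q : ∀ i, Expr K G (J i)) :
      ExprRel K G (Σ i, J i) (.comp (.add p p') q) (.add (.comp p q) (.comp p' q))
  | comp_smul_left {I : Type} {J : I → Type} [Finite I] [∀ i, Finite (J i)] (c : K)
      (p : Expr K G I) (q : ∀ i, Expr K G (J i)) :
      ExprRel K G (Σ i, J i) (.comp (.smul c p) q) (.smul c (.comp p q))
  | comp_add_right {I : Type} {J : I → Type} [Finite I] [DecidableEq I] [∀ i, Finite (J i)]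
      (p : Expr K G I) (q : ∀ i, Expr K G (J i)) (i : I) (x y : Expr K G (J i)) :
      ExprRel K G (Σ i, J i) (.comp p (Function.update q i (.add x y)))
        (.add (.comp p (Function.update q i x)) (.comp p (Function.update q i y)))
  | comp_smul_right {I : Type} {J : I → Type} [Finite I] [DecidableEq I] [∀ i, Finite (J i)]
      (p : Expr K G I) (q : ∀ i, Expr K G (J i)) (i : I) (c : K) (x : Expr K G (J i)) :
      ExprRel K G (Σ i, J i) (.comp p (Function.update q i (.smul c x)))
        (.smul c (.comp p (Function.update q i x)))
  | map_refl {I : Type} [Finite I] (x : Expr K G I) :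
      ExprRel K G I (.map (Equiv.refl I) x) x
  | map_trans {I J L : Type} [Finite I] [Finite J] [Finite L] (e : I ≃ J) (f : J ≃ L)
      (x : Expr K G I) : ExprRel K G L (.map (e.trans f) x) (.map f (.map e x))
  | unit_comp {J : Fin 1 → Type} [∀ i, Finite (J i)] (q : ∀ i, Expr K G (J i)) :
      ExprRel K G (J default) (.map (Equiv.uniqueSigma J) (.comp .unit q)) (q default)
  | comp_unit {I : Type} [Finite I] (p : Expr K G I) :
      ExprRel K G I
        (.map (Equiv.sigmaUnique I (fun _ => Fin 1)) (.comp p (fun _ => .unit))) p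
  | comp_assoc {I : Type} {J : I → Type} {L : ∀ i, J i → Type} [Finite I]
      [∀ i, Finite (J i)] [∀ i j, Finite (L i j)] (p : Expr K G I)
      (q : ∀ i, Expr K G (J i)) (r : ∀ i j, Expr K G (L i j)) :
      ExprRel K G (Σ i, Σ j, L i j)
        (.map (Equiv.sigmaAssoc L) (.comp (.comp p q) (fun x : (Σ i, J i) => r x.1 x.2)))
        (.comp p (fun i => .comp (q i) (r i)))
  | map_comp {I I' : Type} {J : I' → Type} [Finite I] [Finite I'] [∀ i, Finite (J i)]
      (e : I ≃ I') (p : Expr K G I) (q : ∀ i, Expr K G (J i)) :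
      ExprRel K G (Σ i, J i) (.comp (.map e p) q)
        (.map (Equiv.sigmaCongrLeft e) (.comp p (fun i => q (e i))))
  | comp_map {I : Type} {J J' : I → Type} [Finite I] [∀ i, Finite (J i)]
      [∀ i, Finite (J' i)] (f : ∀ i, J i ≃ J' i) (p : Expr K G I)
      (q : ∀ i, Expr K G (J i)) :
      ExprRel K G (Σ i, J' i) (.comp p (fun i => .map (f i) (q i)))
        (.map (Equiv.sigmaCongrRight f) (.comp p q))

/-- The setoid of `ExprRel`. -/
def exprSetoid (K : Type u) [Field K] (G : (I : Type) → [Finite I] → Type v)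
    (I : Type) [Finite I] : Setoid (Expr K G I) :=
  ⟨ExprRel K G I, ExprRel.refl, ExprRel.symm, ExprRel.trans⟩

/-- Operations with set of inputs `I` of the free operad on the symbols `G`. -/
def FreeObj (K : Type u) [Field K] (G : (I : Type) → [Finite I] → Type v)
    (I : Type) [Finite I] : Type (max 1 u v) :=
  Quotient (exprSetoid K G I)

namespace FreeObj

variable {G : (I : Type) → [Finite I] → Type v} {I : Type} [Finite I]

theorem sound {x y : Expr K G I} (h : ExprRel K G I x y) :
    (Quotient.mk (exprSetoid K G I) x : FreeObj K G I) = Quotient.mk (exprSetoid K G I) y :=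
  Quotient.sound h

instance : Add (FreeObj K G I) :=
  ⟨Quotient.map₂ Expr.add (fun _ _ h _ _ h' => ExprRel.add_congr h h')⟩

instance : Zero (FreeObj K G I) := ⟨Quotient.mk (exprSetoid K G I) Expr.zero⟩

instance : SMul K (FreeObj K G I) :=
  ⟨fun c => Quotient.map (Expr.smul c) (fun _ _ h => ExprRel.smul_congr c h)⟩

instance : Neg (FreeObj K G I) := ⟨fun x => (-1 : K) • x⟩

instance : AddCommGroup (FreeObj K G I) where
  nsmul := nsmulRec
  zsmul := zsmulRec
  add_assoc := by
    rintro ⟨x⟩ ⟨y⟩ ⟨z⟩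
    exact sound (ExprRel.add_assoc x y z)
  add_comm := by
    rintro ⟨x⟩ ⟨y⟩
    exact sound (ExprRel.add_comm x y)
  add_zero := by
    rintro ⟨x⟩
    exact sound (ExprRel.add_zero x)
  zero_add := by
    rintro ⟨x⟩
    exact sound ((ExprRel.add_comm _ _).trans (ExprRel.add_zero x))
  neg_add_cancel := by
    rintro ⟨x⟩
    exact sound ((ExprRel.add_comm _ _).trans (ExprRel.add_neg x))

instance : Module K (FreeObj K G I) :=
  Module.ofMinimalAxioms
    (by rintro c ⟨x⟩ ⟨y⟩; exact sound (ExprRel.smul_add c x y))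
    (by rintro c d ⟨x⟩; exact sound (ExprRel.add_smul c d x))
    (by rintro c d ⟨x⟩; exact sound (ExprRel.mul_smul c d x))
    (by rintro ⟨x⟩; exact sound (ExprRel.one_smul x))

/-- The class of a formal expression. -/
def cls (x : Expr K G I) : FreeObj K G I := Quotient.mk (exprSetoid K G I) x

/-- A formal expression representing a given class. -/
noncomputable def out (x : FreeObj K G I) : Expr K G I := Quotient.out x

theorem cls_out (x : FreeObj K G I) : cls (out x) = x := Quotient.out_eq x

theorem cls_eq {x y : Expr K G I} : cls x = cls y ↔ ExprRel K G I x y :=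
  ⟨fun h => Quotient.exact h, fun h => Quotient.sound h⟩

/-- Relabelling in the free operad. -/
def relabel {J : Type} [Finite J] (e : I ≃ J) : FreeObj K G I →ₗ[K] FreeObj K G J where
  toFun := Quotient.map (Expr.map e) (fun _ _ h => ExprRel.map_congr e h)
  map_add' := by
    rintro ⟨x⟩ ⟨y⟩
    exact sound (ExprRel.map_add e x y)
  map_smul' := by
    rintro c ⟨x⟩
    exact sound (ExprRel.map_smul e c x)

theorem cls_comp_eq {J : I → Type} [∀ i, Finite (J i)] {p p' : Expr K G I}
    {q q' : ∀ i, Expr K G (J i)} (hp : cls p = cls p') (hq : ∀ i, cls (q i) = cls (q' i)) :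
    cls (Expr.comp p q) = cls (Expr.comp p' q') :=
  cls_eq.2 (ExprRel.comp_congr (cls_eq.1 hp) fun i => cls_eq.1 (hq i))

/-- Composition in the free operad. -/
noncomputable def compose {J : I → Type} [∀ i, Finite (J i)] :
    FreeObj K G I →ₗ[K] MultilinearMap K (fun i => FreeObj K G (J i)) (FreeObj K G (Σ i, J i)) where
  toFun p :=
    { toFun := fun q => cls (Expr.comp (out p) (fun i => out (q i)))
      map_update_add' := by
        intro _ m i x y
        have e : ∀ (z : FreeObj K G (J i)) (z' : Expr K G (J i)), cls z' = z →
            cls (Expr.comp (out p) (fun j => out (Function.update m i z j))) =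
              cls (Expr.comp (out p) (Function.update (fun j => out (m j)) i z')) := by
          intro z z' hz
          refine cls_comp_eq rfl fun j => ?_
          rw [cls_out]
          rcases eq_or_ne j i with rfl | h
          · rw [Function.update_self, Function.update_self, hz]
          · rw [Function.update_of_ne h, Function.update_of_ne h, cls_out]
        have hxy : cls (Expr.add (out x) (out y)) = x + y := by
          conv_rhs => rw [← cls_out x, ← cls_out y]
          rfl
        rw [e (x + y) _ hxy, e x _ (cls_out x), e y _ (cls_out y)]
        exact sound (ExprRel.comp_add_right _ _ i _ _)
      map_update_smul' := by
        intro _ m i c x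
        have e : ∀ (z : FreeObj K G (J i)) (z' : Expr K G (J i)), cls z' = z →
            cls (Expr.comp (out p) (fun j => out (Function.update m i z j))) =
              cls (Expr.comp (out p) (Function.update (fun j => out (m j)) i z')) := by
          intro z z' hz
          refine cls_comp_eq rfl fun j => ?_
          rw [cls_out]
          rcases eq_or_ne j i with rfl | h
          · rw [Function.update_self, Function.update_self, hz]
          · rw [Function.update_of_ne h, Function.update_of_ne h, cls_out]
        have hx : cls (Expr.smul c (out x)) = c • x := by
          conv_rhs => rw [← cls_out x]
          rfl
        rw [e (c • x) _ hx, e x _ (cls_out x)]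
        exact sound (ExprRel.comp_smul_right _ _ i _ _) }
  map_add' p p' := by
    refine MultilinearMap.ext fun q => ?_
    have h : cls (Expr.add (out p) (out p')) = p + p' := by
      conv_rhs => rw [← cls_out p, ← cls_out p']
      rfl
    exact (cls_comp_eq ((cls_out _).trans h.symm) fun _ => rfl).trans
      (sound (ExprRel.comp_add_left _ _ _))
  map_smul' c p := by
    refine MultilinearMap.ext fun q => ?_
    have h : cls (Expr.smul c (out p)) = c • p := by
      conv_rhs => rw [← cls_out p]
      rfl
    exact (cls_comp_eq ((cls_out _).trans h.symm) fun _ => rfl).trans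
      (sound (ExprRel.comp_smul_left c _ _))

theorem compose_cls {J : I → Type} [∀ i, Finite (J i)] (p : Expr K G I)
    (q : ∀ i, Expr K G (J i)) :
    compose (cls p) (fun i => cls (q i)) = cls (Expr.comp p q) :=
  cls_comp_eq (cls_out _) fun _ => cls_out _

theorem relabel_cls {J : Type} [Finite J] (e : I ≃ J) (x : Expr K G I) :
    relabel e (cls x) = cls (Expr.map e x) := rfl

theorem exists_rep {A : Type} {J : A → Type} [∀ i, Finite (J i)] (q : ∀ i, FreeObj K G (J i)) :
    ∃ q' : ∀ i, Expr K G (J i), q = fun i => cls (q' i) :=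
  ⟨fun i => out (q i), funext fun i => (cls_out (q i)).symm⟩

end FreeObj

open FreeObj in
/-- The free operad on a collection `G` of symbols. -/
noncomputable def free (K : Type u) [Field K] (G : (I : Type) → [Finite I] → Type v) :
    SymmOperad.{u, max 1 u v} K where
  obj I _ := FreeObj K G I
  map e := relabel e
  unit := cls Expr.unit
  comp := compose
  map_refl x := by
    obtain ⟨x, rfl⟩ := Quotient.exists_rep x
    exact sound (ExprRel.map_refl x)
  map_trans e f x := by
    obtain ⟨x, rfl⟩ := Quotient.exists_rep x
    exact sound (ExprRel.map_trans e f x)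
  unit_comp q := by
    obtain ⟨q, rfl⟩ := FreeObj.exists_rep q
    rw [compose_cls, relabel_cls]
    exact sound (ExprRel.unit_comp q)
  comp_unit p := by
    obtain ⟨p, rfl⟩ := Quotient.exists_rep p
    refine Eq.trans ?_ (sound (ExprRel.comp_unit p))
    exact (congrArg (relabel _) (compose_cls p (fun _ => Expr.unit)))
  comp_assoc {I J L} _ _ _ p q r := by
    obtain ⟨p, rfl⟩ := Quotient.exists_rep p
    obtain ⟨q, rfl⟩ := FreeObj.exists_rep q
    obtain ⟨r', hr⟩ : ∃ r' : ∀ i j, Expr K G (L i j), r = fun i j => cls (r' i j) :=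
      ⟨fun i j => out (r i j), by simp only [cls_out]⟩
    subst hr
    have h1 := compose_cls p q
    have h2 := compose_cls (Expr.comp p q) (fun x : (Σ i, J i) => r' x.1 x.2)
    have h3 := compose_cls p (fun i => Expr.comp (q i) (r' i))
    have h4 := ExprRel.comp_assoc p q r'
    simp only [compose_cls]
    exact (congrArg (relabel _) ((congrArg (fun z => compose z
      (fun x : (Σ i, J i) => cls (r' x.1 x.2))) h1).trans h2)).trans
      ((sound h4).trans h3.symm)
  map_comp e p q := by
    obtain ⟨p, rfl⟩ := Quotient.exists_rep p
    obtain ⟨q, rfl⟩ := FreeObj.exists_rep q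
    have h1 := compose_cls (Expr.map e p) q
    have h2 := compose_cls p (fun i => q (e i))
    exact h1.trans ((sound (ExprRel.map_comp e p q)).trans (congrArg (relabel _) h2.symm))
  comp_map f p q := by
    obtain ⟨p, rfl⟩ := Quotient.exists_rep p
    obtain ⟨q, rfl⟩ := FreeObj.exists_rep q
    have h1 := compose_cls p (fun i => Expr.map (f i) (q i))
    have h2 := compose_cls p q
    exact h1.trans ((sound (ExprRel.comp_map f p q)).trans (congrArg (relabel _) h2.symm))

/-- The symbol `g` as an operation of the free operad. -/
def freeGen (K : Type u) [Field K] {G : (I : Type) → [Finite I] → Type v} {I : Type} [Finite I]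
    (g : G I) : (free K G).obj I :=
  FreeObj.cls (Expr.gen g)

/-! ### The free product of two operads -/

/-- `HomDefect P Q j I y` says that `y` is one of the elements of `Q` that must vanish in a
quotient of `Q` for the maps `j` to become a morphism of operads from `P` to that quotient. -/
inductive HomDefect (P : SymmOperad.{u, v} K) (Q : SymmOperad.{u, w} K)
    (j : ∀ (I : Type) [Finite I], P.obj I → Q.obj I) :
    (I : Type) → [Finite I] → Q.obj I → Prop
  | add {I : Type} [Finite I] (x y : P.obj I) :
      HomDefect P Q j I (j I (x + y) - (j I x + j I y))
  | smul {I : Type} [Finite I] (c : K) (x : P.obj I) :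
      HomDefect P Q j I (j I (c • x) - c • j I x)
  | map {I J : Type} [Finite I] [Finite J] (e : I ≃ J) (x : P.obj I) :
      HomDefect P Q j J (j J (P.map e x) - Q.map e (j I x))
  | unit : HomDefect P Q j (Fin 1) (j (Fin 1) P.unit - Q.unit)
  | comp {I : Type} {J : I → Type} [Finite I] [∀ i, Finite (J i)] (p : P.obj I)
      (q : ∀ i, P.obj (J i)) :
      HomDefect P Q j (Σ i, J i)
        (j (Σ i, J i) (P.comp p q) - Q.comp (j I p) (fun i => j (J i) (q i)))

/-- The free product (coproduct) of two operads: the free operad on the operations of both, modulo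
the relations saying that both canonical maps are morphisms of operads. -/
noncomputable def freeProduct (P Q : SymmOperad.{u, v} K) : SymmOperad.{u, max 1 u v} K :=
  (free K (fun I _ => P.obj I ⊕ Q.obj I)).quotient
    ((free K (fun I _ => P.obj I ⊕ Q.obj I)).idealSpan (fun I _ =>
      {y | HomDefect P (free K (fun I _ => P.obj I ⊕ Q.obj I))
            (fun _ _ x => freeGen K (Sum.inl x)) I y ∨
          HomDefect Q (free K (fun I _ => P.obj I ⊕ Q.obj I))
            (fun _ _ x => freeGen K (Sum.inr x)) I y}))

end SymmOperad

/-! ## Binary quadratic operads and Koszul duality -/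

namespace Quadratic

variable {K : Type u} [Field K]

/-- For `E` a module of binary operations, `Tree K E` is the arity-three component of the free
operad on `E`: three copies of `E ⊗ E`, one for each of the shapes
`e(f(x₀, x₁), x₂)`, `e(f(x₁, x₂), x₀)`, `e(f(x₂, x₀), x₁)`. -/
abbrev Tree (K : Type u) [Field K] (E : Type v) [AddCommGroup E] [Module K E] : Type v :=
  Fin 3 → E ⊗[K] E

section

variable {E : Type v} [AddCommGroup E] [Module K E]

/-- `tree K s e f` is the operation `e(f(x_s, x_{s+1}), x_{s+2})`, with indices modulo three. -/
noncomputable def tree (K : Type u) [Field K] {E : Type v} [AddCommGroup E] [Module K E]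
    (s : Fin 3) (e f : E) : Tree K E :=
  Pi.single s (e ⊗ₜ[K] f)

/-- The action of the cyclic permutation `x₀ → x₁ → x₂ → x₀` on `Tree K E`. -/
def rot (K : Type u) [Field K] (E : Type v) [AddCommGroup E] [Module K E] :
    Tree K E →ₗ[K] Tree K E where
  toFun t s := t (s - 1)
  map_add' _ _ := rfl
  map_smul' _ _ := rfl

/-- The action of the transposition `x₀ ↔ x₁` on `Tree K E`, where `τ` is the transposition of
inputs on `E`: for instance `e(f(x₁, x₂), x₀)` becomes `e(f(x₀, x₂), x₁) = e((τ f)(x₂, x₀), x₁)`. -/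
noncomputable def flip (τ : E →ₗ[K] E) : Tree K E →ₗ[K] Tree K E where
  toFun t s := TensorProduct.map LinearMap.id τ (t (Equiv.swap 1 2 s))
  map_add' _ _ := by ext; simp
  map_smul' _ _ := by ext; simp

/-- The pairing between the ternary trees on the dual of `E` and on `E`:
`⟨tree s α β, tree s' e f⟩` is `α e * β f` if `s = s'` and `0` otherwise. -/
noncomputable def pairing (K : Type u) [Field K] {E : Type v} [AddCommGroup E] [Module K E]
    (φ : Tree K (Module.Dual K E)) (t : Tree K E) : K :=
  ∑ s, TensorProduct.dualDistrib K E E (φ s) (t s)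

theorem dualDistrib_map (τ : E →ₗ[K] E) (a : Module.Dual K E ⊗[K] Module.Dual K E)
    (b : E ⊗[K] E) :
    TensorProduct.dualDistrib K E E (TensorProduct.map LinearMap.id (-τ.dualMap) a) b =
      - TensorProduct.dualDistrib K E E a (TensorProduct.map LinearMap.id τ b) := by
  induction a with
  | zero => simp
  | add x y hx hy => simp only [map_add, LinearMap.add_apply, hx, hy]; ring
  | tmul x y =>
    induction b with
    | zero => simp
    | add x y hx hy => simp only [map_add, hx, hy]; ring
    | tmul z w => simp

end

end Quadratic

/-- Binary quadratic data: a finite-dimensional representation `E` of `S₂` (binary generating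
operations, `swap` being the transposition of the two inputs) and an `S₃`-submodule `R` of the
arity-three component of the free operad on `E` (quadratic relations). -/
structure BinaryQuadraticData (K : Type u) [Field K] where
  E : Type v
  [grp : AddCommGroup E]
  [mod : Module K E]
  [fin : FiniteDimensional K E]
  swap : E →ₗ[K] E
  swap_swap : ∀ e, swap (swap e) = e
  R : Submodule K (Quadratic.Tree K E)
  rot_mem : ∀ t ∈ R, Quadratic.rot K E t ∈ R
  flip_mem : ∀ t ∈ R, Quadratic.flip swap t ∈ R

namespace BinaryQuadraticData

open Quadratic SymmOperad

attribute [instance] BinaryQuadraticData.grp BinaryQuadraticData.mod BinaryQuadraticData.fin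

variable {K : Type u} [Field K]

/-- The collection of symbols with one binary symbol for each element of `E`. -/
inductive BinSymbol (E : Type v) : (I : Type) → [Finite I] → Type v
  | op (e : E) : BinSymbol E (Fin 2)

/-- The relations making the symbol map `E → free` linear and compatible with the transposition
of the two inputs. -/
inductive GenRel (D : BinaryQuadraticData.{u, v} K) :
    (I : Type) → [Finite I] → (free K (BinSymbol D.E)).obj I → Prop
  | add (e f : D.E) : GenRel D (Fin 2)
      (freeGen K (.op (e + f)) - (freeGen K (.op e) + freeGen K (.op f)))
  | smul (c : K) (e : D.E) : GenRel D (Fin 2)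
      (freeGen K (.op (c • e)) - c • freeGen K (.op e))
  | swap (e : D.E) : GenRel D (Fin 2)
      (freeGen K (.op (D.swap e)) -
        (free K (BinSymbol D.E)).map (Equiv.swap 0 1) (freeGen K (.op e)))

/-- The ideal generated by the relations `GenRel`. -/
noncomputable def genIdeal (D : BinaryQuadraticData.{u, v} K) : OpIdeal (free K (BinSymbol D.E)) :=
  (free K (BinSymbol D.E)).idealSpan (fun I _ => {y | GenRel D I y})

/-- The free operad on the `S₂`-module `E` placed in arity two. -/
noncomputable def freeOperad (D : BinaryQuadraticData.{u, v} K) : SymmOperad K :=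
  (free K (BinSymbol D.E)).quotient D.genIdeal

/-- The inclusion of the generators in the free operad on `E`. -/
noncomputable def gen (D : BinaryQuadraticData.{u, v} K) : D.E →ₗ[K] D.freeOperad.obj (Fin 2) where
  toFun e := quotientMap _ D.genIdeal (Fin 2) (freeGen K (.op e))
  map_add' e f := by
    refine Eq.trans ?_ (map_add (quotientMap _ D.genIdeal (Fin 2)) _ _)
    exact (Submodule.Quotient.eq _).2 (subset_idealSpan _ _ _ (GenRel.add e f))
  map_smul' c e := by
    refine Eq.trans ?_ (map_smul (quotientMap _ D.genIdeal (Fin 2)) _ _)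
    exact (Submodule.Quotient.eq _).2 (subset_idealSpan _ _ _ (GenRel.smul c e))

/-- The operation `e(f(x_s, x_{s+1}), x_{s+2})` of the free operad on `E`, as a bilinear map. -/
noncomputable def treeOp (D : BinaryQuadraticData.{u, v} K) (s : Fin 3) :
    D.E →ₗ[K] D.E →ₗ[K] D.freeOperad.obj (Fin 3) :=
  (D.freeOperad.nest s).compl₁₂ D.gen D.gen

/-- The canonical map from `Tree K E` to the arity-three component of the free operad on `E`;
it sends `tree K s e f` to `e(f(x_s, x_{s+1}), x_{s+2})`. -/
noncomputable def treeMap (D : BinaryQuadraticData.{u, v} K) :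
    Tree K D.E →ₗ[K] D.freeOperad.obj (Fin 3) :=
  ∑ s, (TensorProduct.lift (D.treeOp s)).comp (LinearMap.proj s)

/-- The image of the quadratic relations in the free operad. -/
inductive RelIn (D : BinaryQuadraticData.{u, v} K) :
    (I : Type) → [Finite I] → D.freeOperad.obj I → Prop
  | rel (t : Tree K D.E) (ht : t ∈ D.R) : RelIn D (Fin 3) (D.treeMap t)

/-- The quadratic operad with generating operations `E` and relations `R`: the quotient of the free
operad on `E` by the ideal generated by `R`. -/
noncomputable def operad (D : BinaryQuadraticData.{u, v} K) : SymmOperad K :=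
  D.freeOperad.quotient (D.freeOperad.idealSpan (fun I _ => {y | RelIn D I y}))

/-- The Koszul dual quadratic data: the generating operations are `E* ⊗ sgn`, the relations are the
orthogonal complement of `R` for the sign-invariant pairing of trees. -/
noncomputable def koszulDual (D : BinaryQuadraticData.{u, v} K) :
    BinaryQuadraticData.{u, max u v} K where
  E := Module.Dual K D.E
  swap := -D.swap.dualMap
  swap_swap α := by
    ext e
    simp [D.swap_swap]
  R :=
    { carrier := {φ | ∀ t ∈ D.R, pairing K φ t = 0}
      add_mem' := fun {a b} ha hb t ht => by
        have : pairing K (a + b) t = pairing K a t + pairing K b t := by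
          simp [pairing, Finset.sum_add_distrib]
        rw [this, ha t ht, hb t ht, add_zero]
      zero_mem' := fun t _ => by simp [pairing]
      smul_mem' := fun c a ha t ht => by
        have : pairing K (c • a) t = c * pairing K a t := by
          simp [pairing, Finset.mul_sum]
        rw [this, ha t ht, mul_zero] }
  rot_mem φ hφ t ht := by
    have : pairing K (rot K _ φ) t = pairing K φ (rot K _ (rot K _ t)) := by
      have h0 : (0 : Fin 3) - 1 = 2 := by decide
      have h1 : (1 : Fin 3) - 1 = 0 := by decide
      have h2 : (2 : Fin 3) - 1 = 1 := by decide
      simp only [pairing, rot, Fin.sum_univ_three, LinearMap.coe_mk, AddHom.coe_mk, h0, h1, h2]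
      ring
    rw [this]
    exact hφ _ (D.rot_mem _ (D.rot_mem _ ht))
  flip_mem φ hφ t ht := by
    have : pairing K (Quadratic.flip (-D.swap.dualMap) φ) t =
        - pairing K φ (Quadratic.flip D.swap t) := by
      simp only [pairing, Quadratic.flip, LinearMap.coe_mk, AddHom.coe_mk, Fin.sum_univ_three,
        dualDistrib_map]
      have h0 : (Equiv.swap (1 : Fin 3) 2) 0 = 0 := by decide
      have h1 : (Equiv.swap (1 : Fin 3) 2) 1 = 2 := by decide
      have h2 : (Equiv.swap (1 : Fin 3) 2) 2 = 1 := by decide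
      rw [h0, h1, h2]
      ring
    rw [this, hφ _ (D.flip_mem _ ht), neg_zero]

end BinaryQuadraticData

/-! ## The operads Lie, As-Com and MP -/

namespace Quadratic

variable (K : Type u) [Field K] {E : Type v} [AddCommGroup E] [Module K E]

/-- The Jacobi relation `b(b(x₀, x₁), x₂) + b(b(x₁, x₂), x₀) + b(b(x₂, x₀), x₁)`. -/
noncomputable def jacobi (b : E) : Set (Tree K E) :=
  {∑ s, tree K s b b}

/-- The associativity relations of a commutative product `m`: the three operations
`m(m(x₀, x₁), x₂)`, `m(m(x₁, x₂), x₀)`, `m(m(x₂, x₀), x₁)` coincide. -/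
noncomputable def assoc (m : E) : Set (Tree K E) :=
  {t | ∃ s s' : Fin 3, t = tree K s m m - tree K s' m m}

/-- The relations `e(f(x, y), z) = 0`. -/
noncomputable def vanish (e f : E) : Set (Tree K E) :=
  {t | ∃ s : Fin 3, t = tree K s e f}

variable {K}

theorem rot_tree (s : Fin 3) (e f : E) : rot K E (tree K s e f) = tree K (s + 1) e f := by
  funext i
  simp only [rot, tree, LinearMap.coe_mk, AddHom.coe_mk, Pi.single_apply, sub_eq_iff_eq_add]

theorem flip_tree (τ : E →ₗ[K] E) (s : Fin 3) (e f : E) :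
    Quadratic.flip τ (tree K s e f) = tree K (Equiv.swap 1 2 s) e (τ f) := by
  funext i
  simp only [Quadratic.flip, tree, LinearMap.coe_mk, AddHom.coe_mk, Pi.single_apply,
    Equiv.swap_apply_eq_iff]
  split_ifs <;> simp

theorem rot_jacobi (b : E) : ∀ t ∈ jacobi K b, rot K E t ∈ jacobi K b := by
  rintro _ rfl
  simp only [jacobi, map_sum, rot_tree, Set.mem_singleton_iff]
  exact Equiv.sum_comp (Equiv.addRight 1) (fun s => tree K s b b)

theorem rot_assoc (m : E) : ∀ t ∈ assoc K m, rot K E t ∈ assoc K m := by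
  rintro _ ⟨s, s', rfl⟩
  exact ⟨s + 1, s' + 1, by rw [map_sub, rot_tree, rot_tree]⟩

theorem rot_vanish (e f : E) : ∀ t ∈ vanish K e f, rot K E t ∈ vanish K e f := by
  rintro _ ⟨s, rfl⟩
  exact ⟨s + 1, rot_tree s e f⟩

theorem tree_neg (s : Fin 3) (e f : E) : tree K s e (-f) = - tree K s e f := by
  rw [tree, TensorProduct.tmul_neg, Pi.single_neg, tree]

theorem flip_jacobi (τ : E →ₗ[K] E) (b : E) (hb : τ b = -b) :
    ∀ t ∈ jacobi K b, Quadratic.flip τ t ∈ Submodule.span K (jacobi K b) := by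
  rintro _ rfl
  have : Quadratic.flip τ (∑ s, tree K s b b) = - ∑ s, tree K s b b := by
    simp only [map_sum, flip_tree, hb, tree_neg, Finset.sum_neg_distrib]
    exact congrArg _ (Equiv.sum_comp (Equiv.swap 1 2) (fun s => tree K s b b))
  rw [this]
  exact Submodule.neg_mem _ (Submodule.subset_span rfl)

theorem flip_assoc (τ : E →ₗ[K] E) (m : E) (hm : τ m = m) :
    ∀ t ∈ assoc K m, Quadratic.flip τ t ∈ Submodule.span K (assoc K m) := by
  rintro _ ⟨s, s', rfl⟩
  exact Submodule.subset_span ⟨_, _, by rw [map_sub, flip_tree, flip_tree, hm]⟩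

theorem flip_vanish (τ : E →ₗ[K] E) (e f : E) (hf : τ f = f ∨ τ f = -f) :
    ∀ t ∈ vanish K e f, Quadratic.flip τ t ∈ Submodule.span K (vanish K e f) := by
  rintro _ ⟨s, rfl⟩
  rw [flip_tree]
  rcases hf with hf | hf
  · exact Submodule.subset_span ⟨_, by rw [hf]⟩
  · rw [hf, tree_neg]
    exact Submodule.neg_mem _ (Submodule.subset_span ⟨_, rfl⟩)

theorem span_stable (f : Tree K E →ₗ[K] Tree K E) (S : Set (Tree K E))
    (h : ∀ t ∈ S, f t ∈ Submodule.span K S) :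
    ∀ t ∈ Submodule.span K S, f t ∈ Submodule.span K S := fun _ ht =>
  (Submodule.span_le.2 h : Submodule.span K S ≤ (Submodule.span K S).comap f) ht

end Quadratic

open Quadratic

/-- The operad of Lie algebras: one anticommutative operation with the Jacobi identity. -/
noncomputable def lieData (K : Type u) [Field K] : BinaryQuadraticData.{u, u} K where
  E := K
  swap := -LinearMap.id
  swap_swap e := by simp
  R := Submodule.span K (jacobi K (1 : K))
  rot_mem := span_stable _ _ fun t ht => Submodule.subset_span (rot_jacobi _ t ht)
  flip_mem := span_stable _ _ (flip_jacobi _ _ (by simp))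

/-- The operad of commutative associative algebras: one commutative associative operation. -/
noncomputable def asComData (K : Type u) [Field K] : BinaryQuadraticData.{u, u} K where
  E := K
  swap := LinearMap.id
  swap_swap e := by simp
  R := Submodule.span K (assoc K (1 : K))
  rot_mem := span_stable _ _ fun t ht => Submodule.subset_span (rot_assoc _ t ht)
  flip_mem := span_stable _ _ (flip_assoc _ _ (by simp))

/-- The operad of mixed-Poisson algebras. The generating operations are an anticommutative bracket
`μ = (1, 0)` and a commutative product `ν = (0, 1)`; the relations are the Jacobi identity for `μ`,
the associativity of `ν`, and the identities `{x y, z} = 0` and `{x, y} z = 0`. -/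
noncomputable def mixedPoissonData (K : Type u) [Field K] : BinaryQuadraticData.{u, u} K where
  E := K × K
  swap := LinearMap.prodMap (-LinearMap.id) LinearMap.id
  swap_swap e := by simp
  R := Submodule.span K (jacobi K ((1, 0) : K × K) ∪ assoc K ((0, 1) : K × K) ∪
    vanish K ((1, 0) : K × K) (0, 1) ∪ vanish K ((0, 1) : K × K) (1, 0))
  rot_mem := span_stable _ _ fun t ht => Submodule.subset_span <| by
    rcases ht with ((ht | ht) | ht) | ht
    · exact .inl (.inl (.inl (rot_jacobi _ t ht)))
    · exact .inl (.inl (.inr (rot_assoc _ t ht)))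
    · exact .inl (.inr (rot_vanish _ _ t ht))
    · exact .inr (rot_vanish _ _ t ht)
  flip_mem := span_stable _ _ fun t ht => by
    rcases ht with ((ht | ht) | ht) | ht
    · exact Submodule.span_mono (fun _ h => .inl (.inl (.inl h)))
        (flip_jacobi _ _ (by simp) t ht)
    · exact Submodule.span_mono (fun _ h => .inl (.inl (.inr h)))
        (flip_assoc _ _ (by simp) t ht)
    · exact Submodule.span_mono (fun _ h => .inl (.inr h))
        (flip_vanish _ _ _ (.inl (by simp)) t ht)
    · exact Submodule.span_mono (fun _ h => .inr h)
        (flip_vanish _ _ _ (.inr (by simp)) t ht)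

/-!
A morphism from a binary quadratic operad `P(E, R)` to an operad `Q` is the same thing as an
`S₂`-equivariant linear map `E → Q(2)` for which every element of `R` evaluates to zero in `Q(3)`
(`BinaryQuadraticData.operadLift`, `BinaryQuadraticData.operad_hom_ext`). It comes from the
universal properties of the free operad (`SymmOperad.freeLift`) and of a quotient
(`SymmOperad.Hom.descend`), together with the naturality of ternary trees
(`BinaryQuadraticData.app_evalTree`). Likewise a morphism from a free product is a pair of morphisms
from the factors (`SymmOperad.coprodLift`, `SymmOperad.freeProduct_hom_ext`).

The relations of `MP^!` are found by linear algebra (`MixedPoisson.koszulDual_R`). Expand an element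
of the three copies of `E^∨ ⊗ E^∨` in the basis `μ^∨`, `ν^∨`. Orthogonality to `{x y, z}` and
`{x, y} z` kills the mixed coefficients; orthogonality to the Jacobi relation of `μ` says that the
three coefficients of `μ^∨ ⊗ μ^∨` have sum zero, which is the span of the associativity relations;
orthogonality to the associativity of `ν` says that the three coefficients of `ν^∨ ⊗ ν^∨` are equal,
which is the span of the Jacobi relation. The sign twist in `E^∨` makes `μ^∨` commutative and `ν^∨`
anticommutative.

So a morphism from `MP^!` to `Q` is a bracket in `Q` with the axioms of `Lie` and a product in `Q`
with those of `As-Com`, without any compatibility, and this is also what a morphism from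
`Lie * As-Com` to `Q` is. The two resulting morphisms between `MP^!` and `Lie * As-Com` are mutually
inverse because both composites fix the generators.
-/

namespace SymmOperad

variable {K : Type u} [Field K]

/-! ### Morphisms of operads -/

/-- A morphism of symmetric operads: linear maps between the components, compatible with
relabellings, the identity operation and composition. -/
structure Hom (P : SymmOperad.{u, v} K) (Q : SymmOperad.{u, w} K) where
  app : ∀ (I : Type) [Finite I], P.obj I →ₗ[K] Q.obj I
  app_map : ∀ {I J : Type} [Finite I] [Finite J] (e : I ≃ J) (x : P.obj I),
    app J (P.map e x) = Q.map e (app I x)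
  app_unit : app (Fin 1) P.unit = Q.unit
  app_comp : ∀ {I : Type} {J : I → Type} [Finite I] [∀ i, Finite (J i)]
    (p : P.obj I) (q : ∀ i, P.obj (J i)),
    app (Σ i, J i) (P.comp p q) = Q.comp (app I p) (fun i => app (J i) (q i))

namespace Hom

universe v₁ v₂ v₃

variable {P : SymmOperad.{u, v₁} K} {Q : SymmOperad.{u, v₂} K} {S : SymmOperad.{u, v₃} K}

/-- The identity morphism. -/
def id (P : SymmOperad.{u, v₁} K) : Hom P P where
  app _ _ := LinearMap.id
  app_map _ _ := rfl
  app_unit := rfl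
  app_comp _ _ := rfl

/-- The composite `g ∘ f` of two morphisms. -/
def comp (g : Hom Q S) (f : Hom P Q) : Hom P S where
  app I _ := (g.app I).comp (f.app I)
  app_map e x := by simp only [LinearMap.comp_apply, f.app_map, g.app_map]
  app_unit := by simp only [LinearMap.comp_apply, f.app_unit, g.app_unit]
  app_comp p q := by simp only [LinearMap.comp_apply, f.app_comp, g.app_comp]

/-- The kernel of a morphism, as an operadic ideal. -/
def ker (f : Hom P Q) : OpIdeal P where
  sub I _ := LinearMap.ker (f.app I)
  map_mem e x hx := by
    rw [LinearMap.mem_ker] at hx ⊢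
    rw [f.app_map, hx, map_zero]
  comp_mem_left p q hp := by
    rw [LinearMap.mem_ker] at hp ⊢
    rw [f.app_comp, hp, map_zero]
    rfl
  comp_mem_right p q i hq := by
    rw [LinearMap.mem_ker] at hq ⊢
    rw [f.app_comp]
    exact MultilinearMap.map_coord_zero _ i hq

theorem app_eq_zero_of_mem_idealSpan (f : Hom P Q)
    (X : ∀ (I : Type) [Finite I], Set (P.obj I))
    (h : ∀ (I : Type) [Finite I], ∀ x ∈ X I, f.app I x = 0)
    {I : Type} [Finite I] {x : P.obj I} (hx : x ∈ (P.idealSpan X).sub I) : f.app I x = 0 := by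
  simp only [idealSpan, Submodule.mem_sInf, Set.mem_ofPred_eq, forall_exists_index,
    and_imp] at hx
  exact LinearMap.mem_ker.1 (hx _ f.ker (fun J _ y hy => LinearMap.mem_ker.2 (h J y hy)) rfl)

/-- Mutually inverse morphisms give an isomorphism of operads. -/
def toIso (f : Hom P Q) (g : Hom Q P)
    (hgf : ∀ (I : Type) [Finite I] (x : P.obj I), g.app I (f.app I x) = x)
    (hfg : ∀ (I : Type) [Finite I] (x : Q.obj I), f.app I (g.app I x) = x) : Iso P Q where
  toEquiv I _ := { f.app I with invFun := g.app I, left_inv := hgf I, right_inv := hfg I }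
  map' e x := f.app_map e x
  unit' := f.app_unit
  comp' p q := f.app_comp p q

theorem app_nest (f : Hom P Q) (s : Fin 3) (x y : P.obj (Fin 2)) :
    f.app (Fin 3) (P.nest s x y) = Q.nest s (f.app (Fin 2) x) (f.app (Fin 2) y) := by
  have h : (fun i => f.app (nestInputs i) (P.nestArgs y i)) = Q.nestArgs (f.app (Fin 2) y) := by
    funext i
    fin_cases i
    · rfl
    · exact f.app_unit
  simp only [nest, LinearMap.mk₂_apply, f.app_map, f.app_comp, h]

/-! ### Universal properties of quotients and of free operads -/

/-- The projection of an operad onto a quotient, as a morphism. -/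
noncomputable def proj (P : SymmOperad.{u, v₁} K) (T : OpIdeal P) : Hom P (P.quotient T) where
  app I _ := quotientMap P T I
  app_map _ _ := rfl
  app_unit := rfl
  app_comp p q := (T.quotComp_mk p q).symm

theorem proj_surjective (T : OpIdeal P) (I : Type) [Finite I] :
    Function.Surjective ((proj P T).app I) :=
  Submodule.mkQ_surjective _

theorem proj_eq_zero (T : OpIdeal P) {I : Type} [Finite I] {x : P.obj I} (hx : x ∈ T.sub I) :
    (proj P T).app I x = 0 :=
  (Submodule.Quotient.mk_eq_zero _).2 hx

/-- The morphism induced on a quotient by a morphism that vanishes on the ideal. -/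
noncomputable def descend (f : Hom P Q) (T : OpIdeal P)
    (h : ∀ (I : Type) [Finite I], ∀ x ∈ T.sub I, f.app I x = 0) : Hom (P.quotient T) Q where
  app I _ := (T.sub I).liftQ (f.app I) (h I)
  app_map e x := by
    obtain ⟨x, rfl⟩ := proj_surjective T _ x
    exact f.app_map e x
  app_unit := f.app_unit
  app_comp p q := by
    obtain ⟨p, rfl⟩ := proj_surjective T _ p
    obtain ⟨q, rfl⟩ := T.exists_rep q
    exact (congrArg ((T.sub _).liftQ (f.app _) (h _)) (T.quotComp_mk p q)).trans (f.app_comp p q)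

end Hom

section Free

variable {G : (I : Type) → [Finite I] → Type v} {Q : SymmOperad.{u, w} K}

/-- The value in `Q` of a formal expression, for given values of the symbols. The recursor is used
directly, as the index `I` of `Expr` is followed by an instance argument. -/
noncomputable def Expr.eval (Q : SymmOperad.{u, w} K)
    (g : ∀ (I : Type) [Finite I], G I → Q.obj I) {I : Type} [Finite I] (x : Expr K G I) :
    Q.obj I :=
  Expr.rec (motive := fun I _ _ => Q.obj I)
    (gen := fun {I} _ x => g I x)
    (zero := 0)
    (add := fun _ _ x y => x + y)
    (smul := fun c _ x => c • x)
    (map := fun e _ x => Q.map e x)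
    (unit := Q.unit)
    (comp := fun _ _ p q => Q.comp p q) x

theorem Expr.eval_eq_of_rel (g : ∀ (I : Type) [Finite I], G I → Q.obj I) {I : Type} [Finite I]
    {x y : Expr K G I} (h : ExprRel K G I x y) : x.eval Q g = y.eval Q g := by
  have hu : ∀ {I : Type} {J : I → Type} [DecidableEq I] [∀ i, Finite (J i)]
      (q : ∀ i, Expr K G (J i)) (i : I) (z : Expr K G (J i)),
      (fun j => (Function.update q i z j).eval Q g) =
        Function.update (fun j => (q j).eval Q g) i (z.eval Q g) := fun q i z =>
    funext fun j => Function.apply_update (fun _ (y : Expr K G _) => y.eval Q g) q i z j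
  induction h with
  | refl => rfl
  | symm _ ih => exact ih.symm
  | trans _ _ ih ih' => exact ih.trans ih'
  | add_congr _ _ ih ih' => exact congrArg₂ (· + ·) ih ih'
  | smul_congr c _ ih => exact congrArg (c • ·) ih
  | map_congr e _ ih => exact congrArg (Q.map e) ih
  | comp_congr _ _ ih ih' => exact congrArg₂ (fun p q => Q.comp p q) ih (funext ih')
  | add_assoc => exact _root_.add_assoc _ _ _
  | add_comm => exact _root_.add_comm _ _
  | add_zero => exact _root_.add_zero _
  | add_neg x =>
    change x.eval Q g + (-1 : K) • x.eval Q g = 0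
    rw [neg_one_smul, add_neg_cancel]
  | smul_add => exact _root_.smul_add _ _ _
  | add_smul => exact _root_.add_smul _ _ _
  | mul_smul => exact SemigroupAction.mul_smul _ _ _
  | one_smul => exact _root_.one_smul _ _
  | map_add => exact _root_.map_add _ _ _
  | map_smul => exact _root_.map_smul _ _ _
  | comp_add_left p p' q =>
    exact congrArg (fun f => f fun i => (q i).eval Q g)
      (_root_.map_add (Q.comp (J := _)) (p.eval Q g) (p'.eval Q g))
  | comp_smul_left c p q =>
    exact congrArg (fun f => f fun i => (q i).eval Q g)
      (_root_.map_smul (Q.comp (J := _)) c (p.eval Q g))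
  | comp_add_right p q i x y =>
    change Q.comp (p.eval Q g) _ = Q.comp (p.eval Q g) _ + Q.comp (p.eval Q g) _
    exact (congrArg _ (hu q i _)).trans ((MultilinearMap.map_update_add _ _ _ _ _).trans
      (congrArg₂ (· + ·) (congrArg _ (hu q i x).symm) (congrArg _ (hu q i y).symm)))
  | comp_smul_right p q i c x =>
    change Q.comp (p.eval Q g) _ = c • Q.comp (p.eval Q g) _
    exact (congrArg _ (hu q i _)).trans ((MultilinearMap.map_update_smul _ _ _ _ _).trans
      (congrArg (c • ·) (congrArg _ (hu q i x).symm)))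
  | map_refl => exact Q.map_refl _
  | map_trans => exact Q.map_trans _ _ _
  | unit_comp => exact Q.unit_comp _
  | comp_unit => exact Q.comp_unit _
  | comp_assoc p q r => exact Q.comp_assoc _ _ (fun i j => (r i j).eval Q g)
  | map_comp => exact Q.map_comp _ _ _
  | comp_map => exact Q.comp_map _ _ _

/-- The morphism from the free operad determined by the values of the symbols. -/
noncomputable def freeLift (g : ∀ (I : Type) [Finite I], G I → Q.obj I) : Hom (free K G) Q where
  app I _ :=
    { toFun := Quotient.lift (fun x => Expr.eval Q g x) (fun _ _ h => Expr.eval_eq_of_rel g h)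
      map_add' := by
        rintro ⟨x⟩ ⟨y⟩
        rfl
      map_smul' := by
        rintro c ⟨x⟩
        rfl }
  app_map e x := by
    obtain ⟨x, rfl⟩ := Quotient.exists_rep x
    rfl
  app_unit := rfl
  app_comp p q := by
    obtain ⟨p, rfl⟩ := Quotient.exists_rep p
    obtain ⟨q, rfl⟩ := FreeObj.exists_rep q
    exact congrArg (Quotient.lift (fun x => Expr.eval Q g x)
      (fun _ _ h => Expr.eval_eq_of_rel g h)) (FreeObj.compose_cls p q)

theorem free_hom_ext {f f' : Hom (free K G) Q}
    (h : ∀ (I : Type) [Finite I] (x : G I),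
      f.app I (freeGen K x) = f'.app I (freeGen K x))
    (I : Type) [Finite I] (x : (free K G).obj I) : f.app I x = f'.app I x := by
  obtain ⟨x, rfl⟩ := Quotient.exists_rep x
  change f.app I (FreeObj.cls x) = f'.app I (FreeObj.cls x)
  induction x with
  | gen x => exact h _ x
  | zero => exact (map_zero (f.app _)).trans (map_zero (f'.app _)).symm
  | add x y ihx ihy =>
    exact (map_add (f.app _) _ _).trans
      ((congrArg₂ (· + ·) ihx ihy).trans (map_add (f'.app _) _ _).symm)
  | smul c x ih =>
    exact (map_smul (f.app _) c _).trans
      ((congrArg (c • ·) ih).trans (map_smul (f'.app _) c _).symm)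
  | map e x ih =>
    exact (f.app_map e _).trans ((congrArg (Q.map e) ih).trans (f'.app_map e _).symm)
  | unit => exact f.app_unit.trans f'.app_unit.symm
  | comp p q ihp ihq =>
    rw [← FreeObj.compose_cls]
    refine (f.app_comp _ _).trans (Eq.trans ?_ (f'.app_comp _ _).symm)
    rw [ihp, funext ihq]

end Free

/-! ### Universal property of the free product -/

section FreeProduct

universe v'

variable {P₁ P₂ : SymmOperad.{u, v} K} {Q : SymmOperad.{u, w} K}

/-- Conversely to `homOfDefect`: if `f` carries the maps `j` to a morphism, it kills the defects. -/
theorem app_homDefect {P : SymmOperad.{u, v} K} {F : SymmOperad.{u, w} K}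
    {Q' : SymmOperad.{u, v'} K} (f : Hom F Q') (h : Hom P Q')
    (j : ∀ (I : Type) [Finite I], P.obj I → F.obj I)
    (hj : ∀ (I : Type) [Finite I] (x : P.obj I), f.app I (j I x) = h.app I x)
    (I : Type) [Finite I] (y : F.obj I) (hy : HomDefect P F j I y) : f.app I y = 0 := by
  cases hy with
  | add x y => rw [map_sub, map_add, hj, hj, hj, map_add, sub_self]
  | smul c x => rw [map_sub, map_smul, hj, hj, map_smul, sub_self]
  | map e x => rw [map_sub, f.app_map, hj, hj, h.app_map, sub_self]
  | unit => rw [map_sub, hj, f.app_unit, h.app_unit, sub_self]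
  | comp p q =>
    rw [map_sub, f.app_comp, hj, hj, h.app_comp]
    simp only [hj, sub_self]

/-- If `f` kills the elements singled out by `HomDefect`, the maps `j` followed by `f` form a
morphism. -/
def homOfDefect {P : SymmOperad.{u, v} K} {F : SymmOperad.{u, w} K}
    {Q' : SymmOperad.{u, v'} K} (f : Hom F Q')
    (j : ∀ (I : Type) [Finite I], P.obj I → F.obj I)
    (h : ∀ (I : Type) [Finite I] (y : F.obj I), HomDefect P F j I y → f.app I y = 0) :
    Hom P Q' where
  app I _ :=
    { toFun := fun x => f.app I (j I x)
      map_add' := fun x y => by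
        have := h _ _ (.add x y)
        rwa [map_sub, map_add, sub_eq_zero] at this
      map_smul' := fun c x => by
        have := h _ _ (.smul c x)
        rwa [map_sub, map_smul, sub_eq_zero] at this }
  app_map e x := by
    have := h _ _ (.map e x)
    rwa [map_sub, f.app_map, sub_eq_zero] at this
  app_unit := by
    have := h _ _ .unit
    rwa [map_sub, f.app_unit, sub_eq_zero] at this
  app_comp p q := by
    have := h _ _ (.comp p q)
    rwa [map_sub, f.app_comp, sub_eq_zero] at this

/-- The canonical morphism from the first factor to the free product. -/
noncomputable def inl (P₁ P₂ : SymmOperad.{u, v} K) : Hom P₁ (freeProduct P₁ P₂) :=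
  homOfDefect (Hom.proj _ _) (fun _ _ x => freeGen K (Sum.inl x))
    (fun _ _ _ hy => Hom.proj_eq_zero _ (subset_idealSpan _ _ _ (.inl hy)))

/-- The canonical morphism from the second factor to the free product. -/
noncomputable def inr (P₁ P₂ : SymmOperad.{u, v} K) : Hom P₂ (freeProduct P₁ P₂) :=
  homOfDefect (Hom.proj _ _) (fun _ _ x => freeGen K (Sum.inr x))
    (fun _ _ _ hy => Hom.proj_eq_zero _ (subset_idealSpan _ _ _ (.inr hy)))

/-- The morphism from the free product determined by its restrictions to the factors. -/
noncomputable def coprodLift (f₁ : Hom P₁ Q) (f₂ : Hom P₂ Q) : Hom (freeProduct P₁ P₂) Q :=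
  (freeLift (fun I _ => Sum.elim (f₁.app I) (f₂.app I))).descend _
    (fun _ _ _ hx => Hom.app_eq_zero_of_mem_idealSpan _ _ (fun I _ y hy => by
      rcases hy with hy | hy
      · exact app_homDefect (freeLift _) f₁ _ (fun _ _ _ => rfl) I y hy
      · exact app_homDefect (freeLift _) f₂ _ (fun _ _ _ => rfl) I y hy) hx)

theorem coprodLift_inl (f₁ : Hom P₁ Q) (f₂ : Hom P₂ Q) {I : Type} [Finite I] (x : P₁.obj I) :
    (coprodLift f₁ f₂).app I ((inl P₁ P₂).app I x) = f₁.app I x :=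
  rfl

theorem coprodLift_inr (f₁ : Hom P₁ Q) (f₂ : Hom P₂ Q) {I : Type} [Finite I] (x : P₂.obj I) :
    (coprodLift f₁ f₂).app I ((inr P₁ P₂).app I x) = f₂.app I x :=
  rfl

theorem freeProduct_hom_ext {f f' : Hom (freeProduct P₁ P₂) Q}
    (h₁ : ∀ (I : Type) [Finite I] (x : P₁.obj I),
      f.app I ((inl P₁ P₂).app I x) = f'.app I ((inl P₁ P₂).app I x))
    (h₂ : ∀ (I : Type) [Finite I] (x : P₂.obj I),
      f.app I ((inr P₁ P₂).app I x) = f'.app I ((inr P₁ P₂).app I x))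
    (I : Type) [Finite I] (x : (freeProduct P₁ P₂).obj I) : f.app I x = f'.app I x := by
  obtain ⟨x, rfl⟩ := Hom.proj_surjective _ _ x
  refine free_hom_ext (f := f.comp (Hom.proj _ _)) (f' := f'.comp (Hom.proj _ _))
    (fun J _ x => ?_) I x
  rcases x with x | x
  · exact h₁ J x
  · exact h₂ J x

end FreeProduct

end SymmOperad

/-! ### Universal property of a binary quadratic operad -/

namespace BinaryQuadraticData

open Quadratic SymmOperad

variable {K : Type u} [Field K]

section EvalTree

universe v₁ v₂

variable {E : Type v} [AddCommGroup E] [Module K E]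

/-- The value in `P` of a combination of ternary trees, when the elements of `E` are interpreted
as binary operations of `P` by `g`. -/
noncomputable def evalTree (P : SymmOperad.{u, v₁} K) (g : E →ₗ[K] P.obj (Fin 2)) :
    Tree K E →ₗ[K] P.obj (Fin 3) :=
  ∑ s, (TensorProduct.lift ((P.nest s).compl₁₂ g g)).comp (LinearMap.proj s)

theorem evalTree_tree (P : SymmOperad.{u, v₁} K) (g : E →ₗ[K] P.obj (Fin 2)) (s : Fin 3)
    (e f : E) : evalTree P g (tree K s e f) = P.nest s (g e) (g f) := by
  rw [evalTree, LinearMap.sum_apply, Finset.sum_eq_single s]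
  · simp [tree]
  · intro i _ hi
    simp [tree, Pi.single_eq_of_ne hi]
  · simp

theorem app_evalTree {P : SymmOperad.{u, v₁} K} {Q : SymmOperad.{u, v₂} K} (h : Hom P Q)
    (g : E →ₗ[K] P.obj (Fin 2)) (t : Tree K E) :
    h.app (Fin 3) (evalTree P g t) = evalTree Q ((h.app (Fin 2)).comp g) t := by
  simp only [evalTree, LinearMap.sum_apply, map_sum, LinearMap.comp_apply]
  refine Finset.sum_congr rfl fun s _ => ?_
  generalize (LinearMap.proj s : Tree K E →ₗ[K] E ⊗[K] E) t = a
  induction a with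
  | zero => simp only [map_zero]
  | add x y hx hy => simp only [map_add, hx, hy]
  | tmul x y => exact h.app_nest s _ _

theorem evalTree_jacobi_eq_zero_iff (P : SymmOperad.{u, v₁} K) (g : E →ₗ[K] P.obj (Fin 2))
    (b : E) : (∀ t ∈ jacobi K b, evalTree P g t = 0) ↔ ∑ s, P.nest s (g b) (g b) = 0 := by
  simp only [jacobi, Set.mem_singleton_iff, forall_eq, map_sum, evalTree_tree]

theorem evalTree_assoc_eq_zero_iff (P : SymmOperad.{u, v₁} K) (g : E →ₗ[K] P.obj (Fin 2))
    (m : E) : (∀ t ∈ assoc K m, evalTree P g t = 0) ↔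
      ∀ s s', P.nest s (g m) (g m) = P.nest s' (g m) (g m) := by
  constructor
  · intro h s s'
    have := h _ ⟨s, s', rfl⟩
    rwa [map_sub, evalTree_tree, evalTree_tree, sub_eq_zero] at this
  · rintro h _ ⟨s, s', rfl⟩
    rw [map_sub, evalTree_tree, evalTree_tree, h s s', sub_self]

theorem evalTree_eq_zero_of_mem_span (P : SymmOperad.{u, v₁} K) (g : E →ₗ[K] P.obj (Fin 2))
    {X : Set (Tree K E)} (h : ∀ t ∈ X, evalTree P g t = 0) :
    ∀ t ∈ Submodule.span K X, evalTree P g t = 0 := fun _ ht =>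
  (Submodule.span_le.2 h : Submodule.span K X ≤ LinearMap.ker (evalTree P g)) ht

end EvalTree

variable (D : BinaryQuadraticData.{u, v} K)

/-- The projection of the free operad on the generators onto the quadratic operad. -/
noncomputable def operadProj : Hom D.freeOperad D.operad :=
  Hom.proj _ _

/-- The generating operations of a quadratic operad. -/
noncomputable def opGen : D.E →ₗ[K] D.operad.obj (Fin 2) :=
  (D.operadProj.app (Fin 2)).comp D.gen

theorem gen_swap (e : D.E) :
    D.gen (D.swap e) = D.freeOperad.map (Equiv.swap 0 1) (D.gen e) :=
  (Submodule.Quotient.eq _).2 (subset_idealSpan _ _ _ (GenRel.swap e))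

theorem opGen_swap (e : D.E) :
    D.opGen (D.swap e) = D.operad.map (Equiv.swap 0 1) (D.opGen e) := by
  rw [opGen, LinearMap.comp_apply, gen_swap, Hom.app_map, LinearMap.comp_apply]

theorem evalTree_opGen {t : Tree K D.E} (ht : t ∈ D.R) : evalTree D.operad D.opGen t = 0 := by
  rw [opGen, ← app_evalTree]
  exact Hom.proj_eq_zero _ (subset_idealSpan _ _ _ (RelIn.rel t ht))

variable {Q : SymmOperad.{u, w} K}

/-- The morphism from the free operad on an `S₂`-module determined by an equivariant map. -/
noncomputable def freeOperadLift (g : D.E →ₗ[K] Q.obj (Fin 2))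
    (hg : ∀ e, g (D.swap e) = Q.map (Equiv.swap 0 1) (g e)) : Hom D.freeOperad Q :=
  (freeLift (Q := Q) (G := BinSymbol D.E) (fun _ _ x => match x with | .op e => g e)).descend _
    (fun _ _ _ hx => Hom.app_eq_zero_of_mem_idealSpan _ _ (fun I _ y hy => by
      cases hy with
      | add e f =>
        rw [map_sub, map_add, sub_eq_zero]
        exact map_add g e f
      | smul c e =>
        rw [map_sub, map_smul, sub_eq_zero]
        exact map_smul g c e
      | swap e =>
        rw [map_sub, Hom.app_map, sub_eq_zero]
        exact hg e) hx)

/-- The morphism from a quadratic operad determined by an equivariant interpretation of the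
generating operations that satisfies the quadratic relations. -/
noncomputable def operadLift (g : D.E →ₗ[K] Q.obj (Fin 2))
    (hg : ∀ e, g (D.swap e) = Q.map (Equiv.swap 0 1) (g e))
    (hR : ∀ t ∈ D.R, evalTree Q g t = 0) : Hom D.operad Q :=
  (D.freeOperadLift g hg).descend _
    (fun _ _ _ hx => Hom.app_eq_zero_of_mem_idealSpan _ _ (fun I _ y hy => by
      obtain ⟨t, ht⟩ := hy
      exact (app_evalTree _ D.gen t).trans (hR t ht)) hx)

theorem operad_hom_ext {f f' : Hom D.operad Q}
    (h : ∀ e, f.app (Fin 2) (D.opGen e) = f'.app (Fin 2) (D.opGen e))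
    (I : Type) [Finite I] (x : D.operad.obj I) : f.app I x = f'.app I x := by
  obtain ⟨x, rfl⟩ := Hom.proj_surjective _ _ x
  obtain ⟨x, rfl⟩ := Hom.proj_surjective _ _ x
  refine free_hom_ext (f := (f.comp (Hom.proj _ _)).comp (Hom.proj _ _))
    (f' := (f'.comp (Hom.proj _ _)).comp (Hom.proj _ _)) (fun J _ x => ?_) I x
  cases x with
  | op e => exact h e

end BinaryQuadraticData

/-! ### The Koszul dual of the mixed-Poisson operad -/

namespace MixedPoisson

open Quadratic SymmOperad BinaryQuadraticData

variable (K : Type u) [Field K]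

/-- The projection `(a, b) ↦ a`, dual to the bracket `μ`. -/
abbrev muDual : Module.Dual K (K × K) := LinearMap.fst K K K

/-- The projection `(a, b) ↦ b`, dual to the product `ν`. -/
abbrev nuDual : Module.Dual K (K × K) := LinearMap.snd K K K

theorem koszulDual_swap_muDual :
    (mixedPoissonData K).koszulDual.swap (muDual K) = muDual K := by
  change -(LinearMap.prodMap (-LinearMap.id) LinearMap.id).dualMap (muDual K) = muDual K
  ext <;> simp

theorem koszulDual_swap_nuDual :
    (mixedPoissonData K).koszulDual.swap (nuDual K) = -nuDual K := by
  change -(LinearMap.prodMap (-LinearMap.id) LinearMap.id).dualMap (nuDual K) = -nuDual K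
  ext <;> simp

theorem dual_eq (α : Module.Dual K (K × K)) :
    α = α (1, 0) • muDual K + α (0, 1) • nuDual K := by
  ext <;> simp

theorem pairing_tree (φ : Tree K (Module.Dual K (K × K))) (s : Fin 3) (e f : K × K) :
    pairing K φ (tree K s e f) = TensorProduct.dualDistrib K _ _ (φ s) (e ⊗ₜ f) := by
  rw [pairing, Finset.sum_eq_single s]
  · simp [tree]
  · intro i _ hi
    simp [tree, Pi.single_eq_of_ne hi]
  · simp

/-- Pairing with a fixed combination of trees on the dual, as a linear form. -/
noncomputable def pairingLeft (φ : Tree K (Module.Dual K (K × K))) :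
    Tree K (K × K) →ₗ[K] K :=
  ∑ s, (TensorProduct.dualDistrib K _ _ (φ s)).comp (LinearMap.proj s)

theorem pairingLeft_apply (φ : Tree K (Module.Dual K (K × K))) (t : Tree K (K × K)) :
    pairingLeft K φ t = pairing K φ t := by
  simp [pairingLeft, pairing]

/-- The expansion of a tensor in the basis of `E* ⊗ E*` given by `μ^∨` and `ν^∨`; the coefficients
are the values of the tensor on the dual basis. -/
theorem dual_tensor_eq (a : Module.Dual K (K × K) ⊗[K] Module.Dual K (K × K)) :
    a = TensorProduct.dualDistrib K _ _ a ((1, 0) ⊗ₜ (1, 0)) • (muDual K ⊗ₜ muDual K) +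
      TensorProduct.dualDistrib K _ _ a ((1, 0) ⊗ₜ (0, 1)) • (muDual K ⊗ₜ nuDual K) +
      TensorProduct.dualDistrib K _ _ a ((0, 1) ⊗ₜ (1, 0)) • (nuDual K ⊗ₜ muDual K) +
      TensorProduct.dualDistrib K _ _ a ((0, 1) ⊗ₜ (0, 1)) • (nuDual K ⊗ₜ nuDual K) := by
  induction a with
  | zero => simp
  | add x y hx hy =>
    nth_rw 1 [hx, hy]
    simp only [map_add, LinearMap.add_apply, add_smul]
    abel
  | tmul α β =>
    nth_rw 1 [dual_eq K α, dual_eq K β]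
    simp only [TensorProduct.dualDistrib_apply, TensorProduct.add_tmul, TensorProduct.tmul_add,
      TensorProduct.smul_tmul_smul]
    abel

/-- Orthogonality to the relations of `MP`, one family of relations at a time: the identities
`{x y, z} = 0` and `{x, y} z = 0` kill the mixed coefficients, the Jacobi relation of `μ` says that
the coefficients of `μ^∨ ⊗ μ^∨` have sum zero, and the associativity of `ν` says that those of
`ν^∨ ⊗ ν^∨` are equal. -/
theorem mem_koszulDual_R_iff (φ : Tree K (Module.Dual K (K × K))) :
    φ ∈ (mixedPoissonData K).koszulDual.R ↔
      (∑ s, TensorProduct.dualDistrib K _ _ (φ s) ((1, 0) ⊗ₜ (1, 0)) = 0) ∧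
      (∀ s s', TensorProduct.dualDistrib K _ _ (φ s) ((0, 1) ⊗ₜ (0, 1)) =
        TensorProduct.dualDistrib K _ _ (φ s') ((0, 1) ⊗ₜ (0, 1))) ∧
      (∀ s, TensorProduct.dualDistrib K _ _ (φ s) ((1, 0) ⊗ₜ (0, 1)) = 0) ∧
      (∀ s, TensorProduct.dualDistrib K _ _ (φ s) ((0, 1) ⊗ₜ (1, 0)) = 0) := by
  have h : φ ∈ (mixedPoissonData K).koszulDual.R ↔
      (mixedPoissonData K).R ≤ LinearMap.ker (pairingLeft K φ) := by
    refine forall₂_congr fun t _ => ?_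
    exact iff_of_eq (congrArg (· = (0 : K)) (pairingLeft_apply K φ t).symm)
  rw [h]
  refine Submodule.span_le.trans ?_
  simp only [Set.union_subset_iff, and_assoc]
  refine and_congr ?_ (and_congr ?_ (and_congr ?_ ?_))
  · simp only [jacobi, Set.singleton_subset_iff, SetLike.mem_coe, LinearMap.mem_ker, map_sum,
      pairingLeft_apply, pairing_tree]
  · constructor
    · intro h s s'
      have := LinearMap.mem_ker.1 (h ⟨s, s', rfl⟩)
      rwa [map_sub, pairingLeft_apply, pairingLeft_apply, pairing_tree, pairing_tree,
        sub_eq_zero] at this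
    · rintro h _ ⟨s, s', rfl⟩
      rw [SetLike.mem_coe, LinearMap.mem_ker, map_sub, pairingLeft_apply, pairingLeft_apply,
        pairing_tree, pairing_tree, h s s', sub_self]
  all_goals
    constructor
    · intro h s
      have := LinearMap.mem_ker.1 (h ⟨s, rfl⟩)
      rwa [pairingLeft_apply, pairing_tree] at this
    · rintro h _ ⟨s, rfl⟩
      rw [SetLike.mem_coe, LinearMap.mem_ker, pairingLeft_apply, pairing_tree, h s]

theorem mem_span_jacobi_assoc {φ : Tree K (Module.Dual K (K × K))}
    (h1 : ∑ s, TensorProduct.dualDistrib K _ _ (φ s) (((1, 0) : K × K) ⊗ₜ ((1, 0) : K × K)) = 0)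
    (h2 : ∀ s s', TensorProduct.dualDistrib K _ _ (φ s) (((0, 1) : K × K) ⊗ₜ ((0, 1) : K × K)) =
      TensorProduct.dualDistrib K _ _ (φ s') (((0, 1) : K × K) ⊗ₜ ((0, 1) : K × K)))
    (h3 : ∀ s, TensorProduct.dualDistrib K _ _ (φ s) (((1, 0) : K × K) ⊗ₜ ((0, 1) : K × K)) = 0)
    (h4 : ∀ s, TensorProduct.dualDistrib K _ _ (φ s) (((0, 1) : K × K) ⊗ₜ ((1, 0) : K × K)) = 0) :
    φ ∈ Submodule.span K (jacobi K (nuDual K) ∪ assoc K (muDual K)) := by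
  set a : Fin 3 → K := fun s =>
    TensorProduct.dualDistrib K _ _ (φ s) (((1, 0) : K × K) ⊗ₜ ((1, 0) : K × K)) with ha
  set d : Fin 3 → K := fun s =>
    TensorProduct.dualDistrib K _ _ (φ s) (((0, 1) : K × K) ⊗ₜ ((0, 1) : K × K)) with hd
  -- As the `a s` have sum zero, the `μ^∨`-part of `φ` is a combination of differences of trees.
  have key : φ = d 0 • ∑ s, tree K s (nuDual K) (nuDual K) +
      ∑ s, a s • (tree K s (muDual K) (muDual K) - tree K 0 (muDual K) (muDual K)) := by
    have h5 : ∑ s, a s • (tree K s (muDual K) (muDual K) - tree K 0 (muDual K) (muDual K)) =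
        ∑ s, a s • tree K s (muDual K) (muDual K) := by
      rw [Finset.sum_congr rfl fun s _ => smul_sub (a s) (tree K s (muDual K) (muDual K))
        (tree K 0 (muDual K) (muDual K))]
      refine (Finset.sum_sub_distrib (fun s => a s • tree K s (muDual K) (muDual K))
        (fun s => a s • tree K 0 (muDual K) (muDual K))).trans ?_
      rw [← Finset.sum_smul, h1, zero_smul]
      exact sub_zero (∑ s, a s • tree K s (muDual K) (muDual K))
    rw [h5]
    funext i
    rw [dual_tensor_eq K (φ i), h3, h4, h2 i 0, zero_smul, zero_smul, add_zero, add_zero,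
      add_comm]
    simp only [Pi.add_apply, Pi.smul_apply, Finset.sum_apply, tree]
    simp [Pi.single_apply, ha, hd, Finset.sum_ite_eq]
  rw [key]
  exact Submodule.add_mem _ (Submodule.smul_mem _ _ (Submodule.subset_span (.inl rfl)))
    (Submodule.sum_mem _ fun s _ => Submodule.smul_mem _ _
      (Submodule.subset_span (.inr ⟨s, 0, rfl⟩)))

theorem jacobi_nuDual_mem : ∑ s, tree K s (nuDual K) (nuDual K) ∈
    (mixedPoissonData K).koszulDual.R := by
  refine (mem_koszulDual_R_iff K _).2 ⟨?_, ?_, ?_, ?_⟩ <;>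
    simp [tree, Finset.sum_apply, Pi.single_apply]

theorem assoc_muDual_mem (s s' : Fin 3) :
    tree K s (muDual K) (muDual K) - tree K s' (muDual K) (muDual K) ∈
      (mixedPoissonData K).koszulDual.R := by
  have h (i j : Fin 3) (e f : K × K) : TensorProduct.dualDistrib K _ _
      (tree K i (muDual K) (muDual K) j) (e ⊗ₜ f) = if j = i then e.1 * f.1 else 0 := by
    rw [tree, Pi.single_apply]
    split_ifs <;> simp
  refine (mem_koszulDual_R_iff K _).2 ⟨?_, ?_, ?_, ?_⟩ <;>
    simp only [Pi.sub_apply, map_sub, LinearMap.sub_apply, h] <;> simp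

theorem koszulDual_R :
    (mixedPoissonData K).koszulDual.R =
      Submodule.span K (jacobi K (nuDual K) ∪ assoc K (muDual K)) := by
  refine le_antisymm (fun φ hφ => ?_) (Submodule.span_le.2 ?_)
  · obtain ⟨h1, h2, h3, h4⟩ := (mem_koszulDual_R_iff K φ).1 hφ
    exact mem_span_jacobi_assoc K h1 h2 h3 h4
  · rintro _ (rfl | ⟨s, s', rfl⟩)
    · exact jacobi_nuDual_mem K
    · exact assoc_muDual_mem K s s'

/-! ### The isomorphism with the free product -/

/-- The bracket of the operad `Lie`. -/
noncomputable def lieBracket : (lieData K).operad.obj (Fin 2) :=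
  (lieData K).opGen (1 : K)

theorem map_lieBracket :
    (lieData K).operad.map (Equiv.swap 0 1) (lieBracket K) = -lieBracket K :=
  ((lieData K).opGen_swap (1 : K)).symm.trans (map_neg (lieData K).opGen (1 : K))

theorem jacobi_lieBracket :
    ∑ s, (lieData K).operad.nest s (lieBracket K) (lieBracket K) = 0 :=
  have h : jacobi K (1 : K) ⊆ Submodule.span K (jacobi K (1 : K)) := Submodule.subset_span
  (evalTree_jacobi_eq_zero_iff (E := K) _ (lieData K).opGen 1).1 fun _ ht =>
    (lieData K).evalTree_opGen (h ht)

/-- The product of the operad `As-Com`. -/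
noncomputable def comProduct : (asComData K).operad.obj (Fin 2) :=
  (asComData K).opGen (1 : K)

theorem map_comProduct :
    (asComData K).operad.map (Equiv.swap 0 1) (comProduct K) = comProduct K :=
  ((asComData K).opGen_swap (1 : K)).symm

theorem assoc_comProduct (s s' : Fin 3) :
    (asComData K).operad.nest s (comProduct K) (comProduct K) =
      (asComData K).operad.nest s' (comProduct K) (comProduct K) :=
  have h : assoc K (1 : K) ⊆ Submodule.span K (assoc K (1 : K)) := Submodule.subset_span
  (evalTree_assoc_eq_zero_iff (E := K) _ (asComData K).opGen 1).1 (fun _ ht =>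
    (asComData K).evalTree_opGen (h ht)) s s'

/-- The operation `ν^∨` of `MP^!`. -/
noncomputable def dualBracket : (mixedPoissonData K).koszulDual.operad.obj (Fin 2) :=
  (mixedPoissonData K).koszulDual.opGen (nuDual K)

/-- The operation `μ^∨` of `MP^!`. -/
noncomputable def dualProduct : (mixedPoissonData K).koszulDual.operad.obj (Fin 2) :=
  (mixedPoissonData K).koszulDual.opGen (muDual K)

theorem map_dualBracket : (mixedPoissonData K).koszulDual.operad.map (Equiv.swap 0 1)
    (dualBracket K) = -dualBracket K :=
  ((mixedPoissonData K).koszulDual.opGen_swap (nuDual K)).symm.trans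
    ((congrArg (mixedPoissonData K).koszulDual.opGen (koszulDual_swap_nuDual K)).trans
      (map_neg (mixedPoissonData K).koszulDual.opGen (nuDual K)))

theorem map_dualProduct : (mixedPoissonData K).koszulDual.operad.map (Equiv.swap 0 1)
    (dualProduct K) = dualProduct K :=
  ((mixedPoissonData K).koszulDual.opGen_swap (muDual K)).symm.trans
    (congrArg (mixedPoissonData K).koszulDual.opGen (koszulDual_swap_muDual K))

theorem jacobi_dualBracket : ∑ s, (mixedPoissonData K).koszulDual.operad.nest s
    (dualBracket K) (dualBracket K) = 0 :=
  have h : jacobi K (nuDual K) ∪ assoc K (muDual K) ⊆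
      Submodule.span K (jacobi K (nuDual K) ∪ assoc K (muDual K)) := Submodule.subset_span
  (evalTree_jacobi_eq_zero_iff (E := Module.Dual K (K × K)) _
    (mixedPoissonData K).koszulDual.opGen (nuDual K)).1 fun _ ht =>
      (mixedPoissonData K).koszulDual.evalTree_opGen
        ((koszulDual_R K).ge (h (.inl ht)))

theorem assoc_dualProduct (s s' : Fin 3) :
    (mixedPoissonData K).koszulDual.operad.nest s (dualProduct K) (dualProduct K) =
      (mixedPoissonData K).koszulDual.operad.nest s' (dualProduct K) (dualProduct K) :=
  have h : jacobi K (nuDual K) ∪ assoc K (muDual K) ⊆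
      Submodule.span K (jacobi K (nuDual K) ∪ assoc K (muDual K)) := Submodule.subset_span
  (evalTree_assoc_eq_zero_iff (E := Module.Dual K (K × K)) _
    (mixedPoissonData K).koszulDual.opGen (muDual K)).1 (fun _ ht =>
      (mixedPoissonData K).koszulDual.evalTree_opGen
        ((koszulDual_R K).ge (h (.inr ht)))) s s'

variable {K} {Q : SymmOperad.{u, w} K}

/-- An anticommutative operation satisfying the Jacobi identity determines a morphism from
`Lie`. -/
noncomputable def lieLift (b : Q.obj (Fin 2)) (hb : Q.map (Equiv.swap 0 1) b = -b)
    (hJ : ∑ s, Q.nest s b b = 0) : Hom (lieData K).operad Q :=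
  (lieData K).operadLift (LinearMap.toSpanSingleton K _ b)
    (fun (e : K) => by
      change (-e) • b = Q.map (Equiv.swap 0 1) (e • b)
      rw [map_smul, hb, smul_neg, neg_smul])
    (evalTree_eq_zero_of_mem_span (E := K) _ (LinearMap.toSpanSingleton K _ b)
      ((evalTree_jacobi_eq_zero_iff _ _ _).2 (by
        rw [LinearMap.toSpanSingleton_apply, one_smul, hJ])))

theorem lieLift_lieBracket (b : Q.obj (Fin 2)) (hb : Q.map (Equiv.swap 0 1) b = -b)
    (hJ : ∑ s, Q.nest s b b = 0) : (lieLift b hb hJ).app (Fin 2) (lieBracket K) = b :=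
  one_smul K b

theorem lie_hom_ext {f f' : Hom (lieData K).operad Q}
    (h : f.app (Fin 2) (lieBracket K) = f'.app (Fin 2) (lieBracket K))
    (I : Type) [Finite I] (x : (lieData K).operad.obj I) : f.app I x = f'.app I x := by
  refine operad_hom_ext _ (fun (e : K) => ?_) I x
  have he : (lieData K).opGen e = e • lieBracket K :=
    (congrArg (lieData K).opGen (mul_one e).symm).trans (map_smul (lieData K).opGen e (1 : K))
  rw [he, map_smul, map_smul, h]

/-- A commutative and associative operation determines a morphism from `As-Com`. -/
noncomputable def asComLift (m : Q.obj (Fin 2)) (hm : Q.map (Equiv.swap 0 1) m = m)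
    (hA : ∀ s s', Q.nest s m m = Q.nest s' m m) : Hom (asComData K).operad Q :=
  (asComData K).operadLift (LinearMap.toSpanSingleton K _ m)
    (fun (e : K) => by
      change e • m = Q.map (Equiv.swap 0 1) (e • m)
      rw [map_smul, hm])
    (evalTree_eq_zero_of_mem_span (E := K) _ (LinearMap.toSpanSingleton K _ m)
      ((evalTree_assoc_eq_zero_iff _ _ _).2 (by
        rwa [LinearMap.toSpanSingleton_apply, one_smul])))

theorem asComLift_comProduct (m : Q.obj (Fin 2)) (hm : Q.map (Equiv.swap 0 1) m = m)
    (hA : ∀ s s', Q.nest s m m = Q.nest s' m m) :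
    (asComLift m hm hA).app (Fin 2) (comProduct K) = m :=
  one_smul K m

theorem asCom_hom_ext {f f' : Hom (asComData K).operad Q}
    (h : f.app (Fin 2) (comProduct K) = f'.app (Fin 2) (comProduct K))
    (I : Type) [Finite I] (x : (asComData K).operad.obj I) : f.app I x = f'.app I x := by
  refine operad_hom_ext _ (fun (e : K) => ?_) I x
  have he : (asComData K).opGen e = e • comProduct K :=
    (congrArg (asComData K).opGen (mul_one e).symm).trans
      (map_smul (asComData K).opGen e (1 : K))
  rw [he, map_smul, map_smul, h]

/-- The linear map sending `ν^∨` to `b` and `μ^∨` to `m`. -/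
def dualInterp (b m : Q.obj (Fin 2)) : Module.Dual K (K × K) →ₗ[K] Q.obj (Fin 2) where
  toFun α := α (1, 0) • m + α (0, 1) • b
  map_add' α β := by
    simp only [LinearMap.add_apply, add_smul]
    abel
  map_smul' c α := by
    simp only [LinearMap.smul_apply, smul_eq_mul, SemigroupAction.mul_smul, smul_add,
      RingHom.id_apply]

theorem dualInterp_nuDual (b m : Q.obj (Fin 2)) : dualInterp b m (nuDual K) = b := by
  simp [dualInterp]

theorem dualInterp_muDual (b m : Q.obj (Fin 2)) : dualInterp b m (muDual K) = m := by
  simp [dualInterp]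

/-- A pair of operations, one satisfying the axioms of a Lie bracket and the other those of a
commutative associative product, determines a morphism from `MP^!`; no compatibility between the
two operations is required. -/
noncomputable def dualLift (b m : Q.obj (Fin 2))
    (hb : Q.map (Equiv.swap 0 1) b = -b) (hJ : ∑ s, Q.nest s b b = 0)
    (hm : Q.map (Equiv.swap 0 1) m = m) (hA : ∀ s s', Q.nest s m m = Q.nest s' m m) :
    Hom (mixedPoissonData K).koszulDual.operad Q :=
  (mixedPoissonData K).koszulDual.operadLift (dualInterp b m)
    (fun (α : Module.Dual K (K × K)) => by
      change (-(α (-1, 0))) • m + (-(α (-0, 1))) • b =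
        Q.map (Equiv.swap 0 1) (α (1, 0) • m + α (0, 1) • b)
      have h : ((-1, 0) : K × K) = -(1, 0) := by simp
      rw [map_add, map_smul, map_smul, hb, hm, h, map_neg, neg_neg, neg_zero, smul_neg, neg_smul])
    (fun t ht => evalTree_eq_zero_of_mem_span (E := Module.Dual K (K × K)) Q (dualInterp b m)
      (fun t ht => ht.elim
        ((evalTree_jacobi_eq_zero_iff _ _ _).2 (by rw [dualInterp_nuDual, hJ]) t)
        ((evalTree_assoc_eq_zero_iff _ _ _).2 (by rwa [dualInterp_muDual]) t))
      t ((koszulDual_R K).le ht))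

theorem dualLift_dualBracket (b m : Q.obj (Fin 2))
    (hb : Q.map (Equiv.swap 0 1) b = -b) (hJ : ∑ s, Q.nest s b b = 0)
    (hm : Q.map (Equiv.swap 0 1) m = m) (hA : ∀ s s', Q.nest s m m = Q.nest s' m m) :
    (dualLift b m hb hJ hm hA).app (Fin 2) (dualBracket K) = b :=
  dualInterp_nuDual b m

theorem dualLift_dualProduct (b m : Q.obj (Fin 2))
    (hb : Q.map (Equiv.swap 0 1) b = -b) (hJ : ∑ s, Q.nest s b b = 0)
    (hm : Q.map (Equiv.swap 0 1) m = m) (hA : ∀ s s', Q.nest s m m = Q.nest s' m m) :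
    (dualLift b m hb hJ hm hA).app (Fin 2) (dualProduct K) = m :=
  dualInterp_muDual b m

theorem dual_hom_ext {f f' : Hom (mixedPoissonData K).koszulDual.operad Q}
    (hb : f.app (Fin 2) (dualBracket K) = f'.app (Fin 2) (dualBracket K))
    (hm : f.app (Fin 2) (dualProduct K) = f'.app (Fin 2) (dualProduct K))
    (I : Type) [Finite I] (x : (mixedPoissonData K).koszulDual.operad.obj I) :
    f.app I x = f'.app I x := by
  refine operad_hom_ext _ (fun (α : Module.Dual K (K × K)) => ?_) I x
  have hα : (mixedPoissonData K).koszulDual.opGen α =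
      α (1, 0) • dualProduct K + α (0, 1) • dualBracket K :=
    (congrArg (mixedPoissonData K).koszulDual.opGen (dual_eq K α)).trans
      ((map_add (mixedPoissonData K).koszulDual.opGen _ _).trans
        (congrArg₂ (· + ·) (map_smul (mixedPoissonData K).koszulDual.opGen _ (muDual K))
          (map_smul (mixedPoissonData K).koszulDual.opGen _ (nuDual K))))
  rw [hα, map_add, map_add, map_smul, map_smul, map_smul, map_smul, hb, hm]

variable (K)

/-- The morphism `MP^! → Lie * As-Com` sending `ν^∨` to the bracket and `μ^∨` to the product. -/
noncomputable def dualToFreeProduct :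
    Hom (mixedPoissonData K).koszulDual.operad
      (freeProduct (lieData K).operad (asComData K).operad) :=
  dualLift ((inl _ _).app _ (lieBracket K)) ((inr _ _).app _ (comProduct K))
    (by rw [← Hom.app_map, map_lieBracket, map_neg])
    (by
      simp only [← Hom.app_nest]
      rw [← map_sum, jacobi_lieBracket, map_zero])
    (by rw [← Hom.app_map, map_comProduct])
    (fun s s' => by rw [← Hom.app_nest, ← Hom.app_nest, assoc_comProduct K s s'])

/-- The morphism `Lie * As-Com → MP^!` sending the bracket to `ν^∨` and the product to `μ^∨`. -/
noncomputable def freeProductToDual :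
    Hom (freeProduct (lieData K).operad (asComData K).operad)
      (mixedPoissonData K).koszulDual.operad :=
  coprodLift (lieLift (dualBracket K) (map_dualBracket K) (jacobi_dualBracket K))
    (asComLift (dualProduct K) (map_dualProduct K) (assoc_dualProduct K))

theorem freeProductToDual_dualToFreeProduct (I : Type) [Finite I]
    (x : (mixedPoissonData K).koszulDual.operad.obj I) :
    (freeProductToDual K).app I ((dualToFreeProduct K).app I x) = x := by
  refine dual_hom_ext (f := (freeProductToDual K).comp (dualToFreeProduct K))
    (f' := Hom.id _) ?_ ?_ I x
  · change (freeProductToDual K).app _ ((dualToFreeProduct K).app _ (dualBracket K)) =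
      dualBracket K
    rw [dualToFreeProduct, dualLift_dualBracket, freeProductToDual, coprodLift_inl,
      lieLift_lieBracket]
  · change (freeProductToDual K).app _ ((dualToFreeProduct K).app _ (dualProduct K)) =
      dualProduct K
    rw [dualToFreeProduct, dualLift_dualProduct, freeProductToDual, coprodLift_inr,
      asComLift_comProduct]

theorem dualToFreeProduct_freeProductToDual (I : Type) [Finite I]
    (x : (freeProduct (lieData K).operad (asComData K).operad).obj I) :
    (dualToFreeProduct K).app I ((freeProductToDual K).app I x) = x := by
  refine freeProduct_hom_ext (f := (dualToFreeProduct K).comp (freeProductToDual K))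
    (f' := Hom.id _) (fun J _ y => ?_) (fun J _ y => ?_) I x
  · refine lie_hom_ext (f := ((dualToFreeProduct K).comp (freeProductToDual K)).comp
      (inl _ _)) (f' := inl _ _) ?_ J y
    change (dualToFreeProduct K).app (Fin 2) ((freeProductToDual K).app (Fin 2)
      ((inl _ _).app (Fin 2) (lieBracket K))) = _
    rw [freeProductToDual, coprodLift_inl, lieLift_lieBracket, dualToFreeProduct,
      dualLift_dualBracket]
  · refine asCom_hom_ext (f := ((dualToFreeProduct K).comp (freeProductToDual K)).comp
      (inr _ _)) (f' := inr _ _) ?_ J y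
    change (dualToFreeProduct K).app (Fin 2) ((freeProductToDual K).app (Fin 2)
      ((inr _ _).app (Fin 2) (comProduct K))) = _
    rw [freeProductToDual, coprodLift_inr, asComLift_comProduct, dualToFreeProduct,
      dualLift_dualProduct]

end MixedPoisson

theorem mainTheorem12 :
    Nonempty (SymmOperad.Iso (mixedPoissonData ℂ).koszulDual.operad
      (SymmOperad.freeProduct (lieData ℂ).operad (asComData ℂ).operad)) ∧
    (mixedPoissonData ℂ).koszulDual.swap (LinearMap.fst ℂ ℂ ℂ) = LinearMap.fst ℂ ℂ ℂ ∧
    (mixedPoissonData ℂ).koszulDual.swap (LinearMap.snd ℂ ℂ ℂ) = -LinearMap.snd ℂ ℂ ℂ ∧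
    (mixedPoissonData ℂ).koszulDual.R =
      Submodule.span ℂ
        (Quadratic.jacobi ℂ (LinearMap.snd ℂ ℂ ℂ : Module.Dual ℂ (ℂ × ℂ)) ∪
          Quadratic.assoc ℂ (LinearMap.fst ℂ ℂ ℂ : Module.Dual ℂ (ℂ × ℂ))) :=
  ⟨⟨SymmOperad.Hom.toIso (MixedPoisson.dualToFreeProduct ℂ) (MixedPoisson.freeProductToDual ℂ)
      (MixedPoisson.freeProductToDual_dualToFreeProduct ℂ)
      (MixedPoisson.dualToFreeProduct_freeProductToDual ℂ)⟩,
    MixedPoisson.koszulDual_swap_muDual ℂ, MixedPoisson.koszulDual_swap_nuDual ℂ,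
    MixedPoisson.koszulDual_R ℂ⟩
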